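/- Let $p\ge 2$ and $n\ge 0$ be integers, let $z_1,\dots,z_n\in\mathbb C$ be pairwise distinct, let $m_1,\dots,m_n$ be positive integers, and put $W(x)=\prod_{j=1}^n(x-z_j)^{m_j}$, $k_0=m_1+\dots+m_n$, $k_p=0$. Let $k_1,\dots,k_{p-1}\ge 0$ be integers such that the integers $$d_l=k_{l-1}-k_l+p-l\qquad(1\le l\le p)$$ (so that $d_1=k_0-k_1+p-1$ and $d_p=k_{p-1}$) satisfy $d_1>d_2>\dots>d_p\ge 0$, and put $D=(d_1,\dots,d_p)$. Consider the $sl_p$ master function of the variables $t=(t_i^{(l)})$, $1\le l\le p-1$, $1\le i\le k_l$, $$\tilde\Phi(t)=\prod_{l=1}^{p-1}\prod_{1\le i<j\le k_l}(t_i^{(l)}-t_j^{(l)})^2\ \prod_{l=2}^{p-1}\prod_{i=1}^{k_{l-1}}\prod_{j=1}^{k_l}(t_i^{(l-1)}-t_j^{(l)})^{-1}\ \prod_{j=1}^n\prod_{i=1}^{k_1}(t_i^{(1)}-z_j)^{-m_j},$$ on the open set $U$ where none of the differences occurring in it vanishes. The group $S=S_{k_1}\times\dots\times S_{k_{p-1}}$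 acts by permuting the variables $t^{(l)}_1,\dots,t^{(l)}_{k_l}$ for each $l$. A $p$-dimensional subspace $V\subset\mathbb C[x]$ has Wronskian $W$ if the Wronski determinant of some (equivalently, any) basis of $V$ is a nonzero multiple of the monic polynomial $W$. It is a nondegenerate $p$-plane of type $D$ if it has a basis $P_1,\dots,P_p$ with $\deg P_l=d_l$ such that, with $\mathrm{Wr}_l=\mathrm{Wr}[P_{l+1},\dots,P_p]$, the polynomials $\mathrm{Wr}_l$ and $\mathrm{Wr}_{l+1}$ have no common roots for every $0\le l\le p-2$. Then the number of $S$-orbits of critical points of $\tilde\Phi$ in $U$ equals the number of nondegenerate $p$-planes of type $D$ with Wronskian $W$. Likewise, the number of $S$-orbits of those critical points for which all $t_i^{(l)}$ are pairwise distinct and different from all $z_j$ equals the number of $p$-planes with Wronskian $W$ having a basis $P_1,\dots,P_p$ with $\deg P_l=d_l$ for which $\mathrm{Wr}_l$ and $\mathrm{Wr}_{l'}$ have no common roots for all $0\le l<l'\le p-1$. -/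

import Mathlib

open Polynomial

/-- The polynomial `W(x) = ∏ⱼ (x - zⱼ)^(mⱼ)`. -/
noncomputable def targetPolynomial {n : ℕ} (z : Fin n → ℂ) (m : Fin n → ℕ) : ℂ[X] :=
  ∏ j, (X - C (z j)) ^ m j

/-- The numbers `k₀, k₁, …, k_{p-1}, k_p`, where `k₀ = m₁ + ⋯ + mₙ`, `k_p = 0`, and
`k₁, …, k_{p-1}` are the values `k 0, …, k (p - 2)`. -/
def extendedK {p n : ℕ} (m : Fin n → ℕ) (k : Fin (p - 1) → ℕ) : ℕ → ℕ
  | 0 => ∑ j, m j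
  | l + 1 => if h : l < p - 1 then k ⟨l, h⟩ else 0

/-! ### The master function -/

/-- The indices of the variables: `⟨l, i⟩` (both counted from `0`) stands for the `i`-th variable
of the `l`-th group `t⁽ˡ⁾`. -/
abbrev VarIndex {p : ℕ} (k : Fin (p - 1) → ℕ) : Type := Σ l : Fin (p - 1), Fin (k l)

/-- The `sl_p` master function. The three factors are the product over pairs of variables in the
same group, the product over pairs of variables in consecutive groups, and the product over
the variables of the first group and the points `zⱼ`. -/
noncomputable def masterFunction {p n : ℕ} (z : Fin n → ℂ) (m : Fin n → ℕ)
    (k : Fin (p - 1) → ℕ) (t : VarIndex k → ℂ) : ℂ :=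
  (∏ l : Fin (p - 1), ∏ i : Fin (k l), ∏ j ∈ Finset.Ioi i, (t ⟨l, i⟩ - t ⟨l, j⟩) ^ 2) *
  (∏ l : Fin (p - 1), ∏ l' ∈ Finset.univ.filter (fun l' : Fin (p - 1) => (l' : ℕ) = (l : ℕ) + 1),
    ∏ i : Fin (k l), ∏ j : Fin (k l'), (t ⟨l, i⟩ - t ⟨l', j⟩)⁻¹) *
  (∏ l ∈ Finset.univ.filter (fun l : Fin (p - 1) => (l : ℕ) = 0),
    ∏ j : Fin n, ∏ i : Fin (k l), (t ⟨l, i⟩ - z j) ^ (-(m j : ℤ)))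

/-- The natural domain of the master function: the open set on which none of the differences that
occur in it vanishes. -/
def masterDomain {p n : ℕ} (z : Fin n → ℂ) (k : Fin (p - 1) → ℕ) : Set (VarIndex k → ℂ) :=
  {t | (∀ (l : Fin (p - 1)) (i j : Fin (k l)), i ≠ j → t ⟨l, i⟩ ≠ t ⟨l, j⟩) ∧
    (∀ (l l' : Fin (p - 1)), (l' : ℕ) = (l : ℕ) + 1 →
      ∀ (i : Fin (k l)) (j : Fin (k l')), t ⟨l, i⟩ ≠ t ⟨l', j⟩) ∧
    (∀ l : Fin (p - 1), (l : ℕ) = 0 → ∀ (i : Fin (k l)) (j : Fin n), t ⟨l, i⟩ ≠ z j)}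

/-- The smaller open set on which all the variables are pairwise distinct and different from all
the points `zⱼ`. -/
def configurationSpace {p n : ℕ} (z : Fin n → ℂ) (k : Fin (p - 1) → ℕ) :
    Set (VarIndex k → ℂ) :=
  {t | Function.Injective t ∧ ∀ (a : VarIndex k) (j : Fin n), t a ≠ z j}

/-- The critical points of the master function lying in the open set `U`
(a subset of the natural domain). -/
def criticalPoints {p n : ℕ} (z : Fin n → ℂ) (m : Fin n → ℕ) (k : Fin (p - 1) → ℕ)
    (U : Set (VarIndex k → ℂ)) : Set (VarIndex k → ℂ) :=
  {t | t ∈ U ∧ fderiv ℂ (masterFunction z m k) t = 0}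

/-- Two points are equivalent when a permutation of the variables within each group, that is, an
element of `S^{k₁} × ⋯ × S^{k_{p-1}}`, takes one to the other. -/
def permSetoid {p : ℕ} (k : Fin (p - 1) → ℕ) : Setoid (VarIndex k → ℂ) where
  r t s := ∃ σ : ∀ l : Fin (p - 1), Equiv.Perm (Fin (k l)), ∀ l i, s ⟨l, i⟩ = t ⟨l, σ l i⟩
  iseqv :=
    { refl := fun _ => ⟨fun _ => 1, fun _ _ => rfl⟩
      symm := by
        rintro t s ⟨σ, h⟩
        exact ⟨fun l => (σ l)⁻¹, fun l i => by rw [h]; simp⟩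
      trans := by
        rintro t s u ⟨σ, h⟩ ⟨τ, h'⟩
        exact ⟨fun l => σ l * τ l, fun l i => by rw [h', h]; rfl⟩ }

/-- The orbits of the points of `A` under permutations of the variables within each group. -/
def OrbitsOf {p : ℕ} (k : Fin (p - 1) → ℕ) (A : Set (VarIndex k → ℂ)) : Type :=
  Quotient ((permSetoid k).comap (Subtype.val : A → VarIndex k → ℂ))

/-! ### Wronskians and nondegenerate planes -/

/-- The Wronskian `det (f_j^{(i)})` of a finite sequence of polynomials. -/
noncomputable def wronskianDet {r : ℕ} (f : Fin r → ℂ[X]) : ℂ[X] :=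
  (Matrix.of fun i j : Fin r => derivative^[(i : ℕ)] (f j)).det

/-- `V` is a `p`-dimensional plane of polynomials, and `w` is its Wronskian: the monic polynomial
proportional to the Wronskian of a basis of `V`. -/
def IsPlaneWithWronskian (p : ℕ) (V : Submodule ℂ ℂ[X]) (w : ℂ[X]) : Prop :=
  w.Monic ∧ ∃ (b : Module.Basis (Fin p) ℂ V) (c : ℂ), c ≠ 0 ∧
    wronskianDet (fun i => (b i : ℂ[X])) = C c * w

/-- `Wr_l = Wr[P_{l+1}, …, P_p]`; the polynomials `P₁, …, P_p` are `P 0, …, P (p - 1)`. -/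
noncomputable def tailWronskian {p : ℕ} (P : Fin p → ℂ[X]) (l : ℕ) : ℂ[X] :=
  wronskianDet fun j : Fin (p - l) => P ⟨l + j, by have := j.isLt; omega⟩

/-- `P` is a basis of `V` with `deg P_l = d_l`
(for distinct `d_l`, linear independence is automatic). -/
def IsBasisOfDegrees {p : ℕ} (V : Submodule ℂ ℂ[X]) (d : Fin p → ℕ) (P : Fin p → ℂ[X]) : Prop :=
  LinearIndependent ℂ P ∧ Submodule.span ℂ (Set.range P) = V ∧
    ∀ l, (P l).degree = (d l : WithBot ℕ)

/-- Two polynomials without common roots. -/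
def NoCommonRoots (f g : ℂ[X]) : Prop := ∀ x : ℂ, ¬ (f.IsRoot x ∧ g.IsRoot x)

/-- `V` is a nondegenerate `p`-plane of type `d = (d₁, …, d_p)`: the polynomials `Wr_l` and
`Wr_{l+1}` have no common roots for `0 ≤ l ≤ p - 2`. -/
def IsNondegenerate {p : ℕ} (V : Submodule ℂ ℂ[X]) (d : Fin p → ℕ) : Prop :=
  ∃ P : Fin p → ℂ[X], IsBasisOfDegrees V d P ∧
    ∀ l : ℕ, l + 1 < p → NoCommonRoots (tailWronskian P l) (tailWronskian P (l + 1))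

/-- The stronger condition that `Wr_l` and `Wr_{l'}` have no common roots for all
`0 ≤ l < l' ≤ p - 1`. -/
def IsStronglyNondegenerate {p : ℕ} (V : Submodule ℂ ℂ[X]) (d : Fin p → ℕ) : Prop :=
  ∃ P : Fin p → ℂ[X], IsBasisOfDegrees V d P ∧
    ∀ l l' : ℕ, l < l' → l' < p → NoCommonRoots (tailWronskian P l) (tailWronskian P l')

/-! To a point `t` attach the monic polynomials `y_l` with roots `t_i^{(l)}`, together with `y_0 =
W` and `y_p = 1`; an orbit is the same thing as such a tuple. At a simple root of `y_l` the critical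
point equation reads `y_l''/y_l' = (y_{l-1} y_{l+1})'/(y_{l-1} y_{l+1})`, that is, `y_{l-1} y_{l+1}
/ y_l^2` has no residue there (`fderiv_masterFunction_eq_zero_iff`,
`residueFree_pointPolynomial_iff`).

If the `y_l` are the Wronskians `Wr_l` of a plane, the identity `wronskian_wr` exhibits this
quotient as the derivative of a rational function `B / y_l`, so its residues vanish, and coprimality
of neighbours makes the roots simple (`isBetheTuple_wr`). Conversely, a residue-free quotient has a
primitive `u / y_l` with `u` a polynomial (`exists_mul_derivative_sub_eq`), and iterated integration
rebuilds a basis from the `y_l` (`IsBetheTuple.exists_wr_update`, `IsBetheTuple.exists_sequence`).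
The degrees fit because a Wronskian of polynomials of distinct degrees has the expected degree
(`wronskianDet_natDegree`).

The Wronskians determine the flag of spans (`mem_spanLT_of_associated_wr`), while the degrees single
out that flag inside the plane, so the plane determines the Wronskians up to scalars
(`associated_wr_of_spanLT_eq`). Hence orbits and planes correspond bijectively, and the coprimality
conditions translate directly, which gives both counts (`mk_orbitsOf_eq`).

Sequences are indexed from the lowest degree upwards: `f j` is `P_{p-j}` and `Y j` is `y_{p-j}`. -/

/-! ### Wronskians -/

/-- The determinant of the derivatives of orders `I i` of the polynomials `g j`. -/
noncomputable def generalizedWronskian {ι : Type*} [Fintype ι] [DecidableEq ι] (I : ι → ℕ)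
    (g : ι → ℂ[X]) : ℂ[X] :=
  (Matrix.of fun i j : ι => derivative^[I i] (g j)).det

/-- The Wronskian of the first `r` terms of a sequence of polynomials. -/
noncomputable def wr (f : ℕ → ℂ[X]) (r : ℕ) : ℂ[X] :=
  wronskianDet fun j : Fin r => f j

lemma wr_eq (f : ℕ → ℂ[X]) (r : ℕ) :
    wr f r = generalizedWronskian (fun i : Fin r => (i : ℕ)) (fun j : Fin r => f j) := rfl

lemma wr_zero (f : ℕ → ℂ[X]) : wr f 0 = 1 := by
  simp [wr, wronskianDet]

lemma wr_congr {f g : ℕ → ℂ[X]} {r : ℕ} (h : ∀ j < r, f j = g j) : wr f r = wr g r := by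
  unfold wr
  congr 1
  funext j
  exact h j j.isLt

lemma generalizedWronskian_equiv {ι κ : Type*} [Fintype ι] [DecidableEq ι] [Fintype κ]
    [DecidableEq κ] (e : κ ≃ ι) (I : ι → ℕ) (g : ι → ℂ[X]) :
    generalizedWronskian (I ∘ e) (g ∘ e) = generalizedWronskian I g := by
  unfold generalizedWronskian
  rw [← Matrix.det_submatrix_equiv_self e]
  rfl

lemma Matrix.derivative_det_eq_sum_updateCol {n : Type*} [Fintype n] [DecidableEq n]
    (M : Matrix n n ℂ[X]) :
    derivative M.det = ∑ k, (M.updateCol k fun i => derivative (M i k)).det := by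
  simp only [Matrix.det_apply', derivative_sum]
  rw [Finset.sum_comm]
  refine Finset.sum_congr rfl fun σ _ => ?_
  rw [← Finset.mul_sum, derivative_intCast_mul, derivative_prod_finset]
  congr 1
  refine Finset.sum_congr rfl fun k _ => ?_
  rw [← Finset.prod_erase_mul _ _ (Finset.mem_univ k)]
  congr 1
  · refine Finset.prod_congr rfl fun j hj => ?_
    rw [Matrix.updateCol_ne (Finset.ne_of_mem_erase hj)]
  · rw [Matrix.updateCol_self]

/-- Differentiating the determinant row by row, only the last row contributes. -/
lemma derivative_wr (f : ℕ → ℂ[X]) (r : ℕ) :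
    derivative (wr f (r + 1)) =
      generalizedWronskian (fun i : Fin (r + 1) => if i = Fin.last r then r + 1 else (i : ℕ))
        (fun j => f j) := by
  rw [wr_eq, generalizedWronskian, ← Matrix.det_transpose, Matrix.derivative_det_eq_sum_updateCol,
    Finset.sum_eq_single (Fin.last r)]
  · refine Eq.trans ?_ (Matrix.det_transpose _)
    congr 1
    ext1 i j
    by_cases hj : j = Fin.last r
    · subst hj
      simp [Function.iterate_succ_apply']
    · simp [hj]
  -- Differentiating row `k` of the Wronskian reproduces row `k + 1`, so the determinant has two
  -- equal rows (columns after transposing).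
  · intro k _ hk
    have hk' : (k : ℕ) < r := Fin.val_lt_last hk
    refine Matrix.det_zero_of_column_eq (i := k) (j := ⟨k + 1, by omega⟩) ?_ fun i => ?_
    · intro h
      have := congrArg Fin.val h
      simp at this
    · rw [Matrix.updateCol_self, Matrix.updateCol_ne]
      · simp [Function.iterate_succ_apply']
      · intro h
        have := congrArg Fin.val h
        simp at this
  · simp

/-! ### The Desnanot–Jacobi identity and Wronskians of Wronskians -/

/-- All determinants are read off the 2 × 2 Schur complement `D - C A⁻¹ B`: its entries times
`A.det` are the bordered minors, and its determinant times `A.det` is the full determinant. -/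
lemma Matrix.det_bordered_mul_det_field {K m : Type*} [Field K] [Fintype m] [DecidableEq m]
    (A : Matrix m m K) (B : Matrix m (Fin 2) K) (C : Matrix (Fin 2) m K)
    (D : Matrix (Fin 2) (Fin 2) K) (hA : A.det ≠ 0) (minor : Fin 2 → Fin 2 → K)
    (hminor : ∀ a b, minor a b = (Matrix.fromBlocks A (B.submatrix id fun _ : Fin 1 => b)
      (C.submatrix (fun _ : Fin 1 => a) id)
      (D.submatrix (fun _ : Fin 1 => a) (fun _ : Fin 1 => b))).det) :
    A.det * (Matrix.fromBlocks A B C D).det =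
      minor 0 0 * minor 1 1 - minor 0 1 * minor 1 0 := by
  have : Invertible A := Matrix.invertibleOfIsUnitDet A (isUnit_iff_ne_zero.mpr hA)
  have key : ∀ a b, minor a b = A.det * (D - C * ⅟A * B) a b := by
    intro a b
    rw [hminor, Matrix.det_fromBlocks₁₁, Matrix.det_unique (n := Fin 1)]
    rfl
  rw [Matrix.det_fromBlocks₁₁, Matrix.det_fin_two, key, key, key, key]
  ring

/-- The Desnanot–Jacobi identity. -/
lemma Matrix.det_bordered_mul_det {R m : Type*} [CommRing R] [IsDomain R] [Fintype m]
    [DecidableEq m]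
    (A : Matrix m m R) (B : Matrix m (Fin 2) R) (C : Matrix (Fin 2) m R)
    (D : Matrix (Fin 2) (Fin 2) R) (hA : A.det ≠ 0) (minor : Fin 2 → Fin 2 → R)
    (hminor : ∀ a b, minor a b = (Matrix.fromBlocks A (B.submatrix id fun _ : Fin 1 => b)
      (C.submatrix (fun _ : Fin 1 => a) id)
      (D.submatrix (fun _ : Fin 1 => a) (fun _ : Fin 1 => b))).det) :
    A.det * (Matrix.fromBlocks A B C D).det =
      minor 0 0 * minor 1 1 - minor 0 1 * minor 1 0 := by
  -- Over the fraction field `A` becomes invertible.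
  let φ := algebraMap R (FractionRing R)
  have hφ : Function.Injective φ := IsFractionRing.injective R (FractionRing R)
  apply hφ
  have h := Matrix.det_bordered_mul_det_field (A.map φ) (B.map φ) (C.map φ) (D.map φ)
    (by
      have : (A.map φ).det = φ A.det := (RingHom.map_det φ A).symm
      rw [this]
      exact (map_ne_zero_iff φ hφ).mpr hA)
    (fun a b => φ (minor a b)) (by
      intro a b
      rw [hminor, RingHom.map_det, RingHom.mapMatrix_apply, Matrix.fromBlocks_map]
      rfl)
  rw [map_sub, map_mul, map_mul, map_mul, ← h, RingHom.map_det, RingHom.map_det,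
    RingHom.mapMatrix_apply, RingHom.mapMatrix_apply, Matrix.fromBlocks_map]

/-- The Wronskian of two Wronskians that differ in their last functions. -/
lemma wronskian_wr (f : ℕ → ℂ[X]) (g : ℂ[X]) (r : ℕ) (h0 : wr f r ≠ 0) :
    wr f (r + 1) * derivative (wr (Function.update f r g) (r + 1)) -
      derivative (wr f (r + 1)) * wr (Function.update f r g) (r + 1) =
    wr f r * wr (Function.update f (r + 1) g) (r + 2) := by
  -- The matrix `A` is that of `wr f r`, bordered by the columns of `f r` and `g` and the rows of
  -- orders `r` and `r + 1`. Column `b` with row 0 gives a Wronskian, with row 1 its derivative.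
  let G : Fin 2 → ℂ[X] := ![f r, g]
  let F : Fin 2 → ℕ → ℂ[X] := ![f, Function.update f r g]
  let c : Fin 2 → Fin r ⊕ Fin 1 → ℂ[X] := fun b => Sum.elim (fun j => f j) (fun _ => G b)
  let I : Fin 2 → Fin r ⊕ Fin 1 → ℕ := fun a => Sum.elim (fun j => (j : ℕ)) (fun _ => r + a)
  have hc : ∀ b, (fun j : Fin (r + 1) => F b j) ∘ finSumFinEquiv = c b := by
    intro b
    funext j
    rcases j with j | j
    · have := j.isLt.ne
      fin_cases b
      · simp [c, F]
      · simp [c, F, this]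
    · fin_cases b <;> fin_cases j <;> simp [c, F, G]
  have h0' : ∀ b, wr (F b) (r + 1) = generalizedWronskian (I 0) (c b) := by
    intro b
    rw [wr_eq, ← generalizedWronskian_equiv finSumFinEquiv, hc]
    congr 1
    funext j
    rcases j with j | j
    · simp [I]
    · fin_cases j; simp [I]
  have h1' : ∀ b, derivative (wr (F b) (r + 1)) = generalizedWronskian (I 1) (c b) := by
    intro b
    rw [derivative_wr, ← generalizedWronskian_equiv finSumFinEquiv, hc]
    congr 1
    funext j
    rcases j with j | j
    · have := j.isLt.ne
      simp [I, Fin.ext_iff, this]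
    · fin_cases j; simp [I, Fin.ext_iff]
  have h2 : wr (Function.update f (r + 1) g) (r + 2) = generalizedWronskian
      (Sum.elim (fun j : Fin r => (j : ℕ)) (fun a : Fin 2 => r + a))
      (Sum.elim (fun j : Fin r => f j) G) := by
    rw [wr_eq, ← generalizedWronskian_equiv (finSumFinEquiv (m := r) (n := 2))]
    congr 1
    · funext j
      rcases j with j | j
      · simp
      · simp
    · funext j
      rcases j with j | j
      · have : (j : ℕ) ≠ r + 1 := by have := j.isLt; omega
        simp [this]
      · fin_cases j <;> simp [G]
  have key := Matrix.det_bordered_mul_det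
    (Matrix.of fun i j : Fin r => derivative^[(i : ℕ)] (f j))
    (Matrix.of fun (i : Fin r) (b : Fin 2) => derivative^[(i : ℕ)] (G b))
    (Matrix.of fun (a : Fin 2) (j : Fin r) => derivative^[r + (a : ℕ)] (f j))
    (Matrix.of fun (a b : Fin 2) => derivative^[r + (a : ℕ)] (G b)) h0
    (fun a b => generalizedWronskian (I a) (c b)) (by
      intro a b
      unfold generalizedWronskian
      congr 1
      ext1 i j
      rcases i with i | i <;> rcases j with j | j <;> rfl)
  have e0 := h0' 0
  have e1 := h0' 1
  have e2 := h1' 0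
  have e3 := h1' 1
  simp only [F, Matrix.cons_val_zero, Matrix.cons_val_one] at e0 e1 e2 e3
  rw [e2, e3, e0, e1, h2]
  have h3 : generalizedWronskian (Sum.elim (fun j : Fin r => (j : ℕ)) (fun a : Fin 2 => r + a))
      (Sum.elim (fun j : Fin r => f j) G) = (Matrix.fromBlocks
        (Matrix.of fun i j : Fin r => derivative^[(i : ℕ)] (f j))
        (Matrix.of fun (i : Fin r) (b : Fin 2) => derivative^[(i : ℕ)] (G b))
        (Matrix.of fun (a : Fin 2) (j : Fin r) => derivative^[r + (a : ℕ)] (f j))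
        (Matrix.of fun (a b : Fin 2) => derivative^[r + (a : ℕ)] (G b))).det := by
    unfold generalizedWronskian
    congr 1
    ext1 i j
    rcases i with i | i <;> rcases j with j | j <;> rfl
  rw [h3]
  refine Eq.trans ?_ key.symm
  ring

/-! ### Change of basis and degrees of Wronskians -/

/-- Derivatives are linear, so the constant matrix of coefficients factors out. Its determinant `c`
may be zero. -/
lemma wronskianDet_eq_C_mul {r : ℕ} {f g : Fin r → ℂ[X]}
    (h : ∀ j, g j ∈ Submodule.span ℂ (Set.range f)) :
    ∃ c : ℂ, wronskianDet g = C c * wronskianDet f := by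
  simp only [Submodule.mem_span_range_iff_exists_fun] at h
  choose a ha using h
  refine ⟨(Matrix.of fun i j => a j i).det, ?_⟩
  rw [RingHom.map_det, mul_comm, wronskianDet, wronskianDet, ← Matrix.det_mul]
  congr 1
  ext1 i j
  rw [Matrix.of_apply, ← ha j, iterate_derivative_sum, Matrix.mul_apply]
  refine Finset.sum_congr rfl fun k _ => ?_
  rw [iterate_derivative_smul, smul_eq_C_mul, mul_comm]
  rfl

lemma coeff_prod_sum_of_natDegree_le {ι : Type*} (s : Finset ι) (q : ι → ℂ[X]) (e : ι → ℕ)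
    (h : ∀ i ∈ s, (q i).natDegree ≤ e i) :
    (∏ i ∈ s, q i).coeff (∑ i ∈ s, e i) = ∏ i ∈ s, (q i).coeff (e i) := by
  classical
  induction s using Finset.induction_on with
  | empty => simp
  | insert a s ha ih =>
    have hs : ∀ i ∈ s, (q i).natDegree ≤ e i := fun i hi => h i (Finset.mem_insert_of_mem hi)
    rw [Finset.prod_insert ha, Finset.sum_insert ha, Finset.prod_insert ha,
      coeff_mul_add_eq_of_natDegree_le (h a (Finset.mem_insert_self a s))
        ((natDegree_prod_le _ _).trans (Finset.sum_le_sum hs)), ih hs]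

lemma natDegree_X_pow_mul_iterate_derivative_le (q : ℂ[X]) (i : ℕ) :
    (X ^ i * derivative^[i] q).natDegree ≤ q.natDegree := by
  rcases lt_or_ge q.natDegree i with h | h
  · rw [iterate_derivative_eq_zero h]
    simp
  · refine natDegree_mul_le.trans ?_
    have := natDegree_iterate_derivative q i
    rw [natDegree_X_pow]
    omega

lemma coeff_X_pow_mul_iterate_derivative (q : ℂ[X]) (i e : ℕ) :
    (X ^ i * derivative^[i] q).coeff e = (e.descFactorial i : ℂ) * q.coeff e := by
  rw [coeff_X_pow_mul']
  split_ifs with h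
  · rw [coeff_iterate_derivative, Nat.sub_add_cancel h, nsmul_eq_mul]
  · rw [Nat.descFactorial_of_lt (not_le.mp h)]
    simp

/-- Falling factorials are monic polynomials of degree `i` in `e j`, so this is a Vandermonde
determinant. -/
lemma det_descFactorial_ne_zero {r : ℕ} (e : Fin r → ℕ) (he : Function.Injective e) :
    (Matrix.of fun i j : Fin r => ((e j).descFactorial i : ℂ)).det ≠ 0 := by
  have h := Matrix.det_eval_matrixOfPolynomials_eq_det_vandermonde (fun i => (e i : ℂ))
    (fun j : Fin r => descPochhammer ℂ j) (fun j => descPochhammer_natDegree ℂ j)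
    (fun j => monic_descPochhammer ℂ j)
  rw [← Matrix.det_transpose]
  have h' : (Matrix.of fun i j : Fin r => ((e j).descFactorial i : ℂ)).transpose =
      Matrix.of fun i j : Fin r => (descPochhammer ℂ j).eval (e i : ℂ) := by
    ext1 i j
    simp [descPochhammer_eval_eq_descFactorial]
  rw [h', ← h, Matrix.det_vandermonde_ne_zero_iff]
  intro a b hab
  exact he (Nat.cast_injective hab)

/-- The Wronskian of polynomials of pairwise distinct degrees has the expected degree. -/
lemma wronskianDet_natDegree {r : ℕ} (f : Fin r → ℂ[X]) (hf : ∀ j, f j ≠ 0)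
    (hinj : Function.Injective fun j => (f j).natDegree) :
    wronskianDet f ≠ 0 ∧
      (wronskianDet f).natDegree + ∑ j : Fin r, (j : ℕ) = ∑ j, (f j).natDegree := by
  set N := ∑ j, (f j).natDegree
  -- Multiplying row `i` by `X ^ i` bounds every entry of column `j` by the degree of `f j`; the
  -- coefficient of order `N` is then the determinant of the leading coefficients.
  have h1 : X ^ (∑ j : Fin r, (j : ℕ)) * wronskianDet f =
      (Matrix.of fun i j : Fin r => X ^ (i : ℕ) * derivative^[(i : ℕ)] (f j)).det := by
    rw [wronskianDet, ← Finset.prod_pow_eq_pow_sum]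
    exact (Matrix.det_mul_column _ _).symm
  have h2 : (X ^ (∑ j : Fin r, (j : ℕ)) * wronskianDet f).coeff N ≠ 0 := by
    have h3 : (X ^ (∑ j : Fin r, (j : ℕ)) * wronskianDet f).coeff N =
        (Matrix.of fun i j : Fin r =>
          (f j).leadingCoeff * (((f j).natDegree).descFactorial i : ℂ)).det := by
      rw [h1, Matrix.det_apply', Matrix.det_apply', finsetSum_coeff]
      refine Finset.sum_congr rfl fun σ _ => ?_
      rw [← C_eq_intCast, coeff_C_mul, coeff_prod_sum_of_natDegree_le]
      · congr 1
        refine Finset.prod_congr rfl fun j _ => ?_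
        simp only [Matrix.of_apply]
        rw [coeff_X_pow_mul_iterate_derivative, mul_comm]
        rfl
      · intro j _
        exact natDegree_X_pow_mul_iterate_derivative_le _ _
    rw [h3]
    have h4 := Matrix.det_mul_row (fun j => (f j).leadingCoeff)
      (Matrix.of fun i j : Fin r => (((f j).natDegree).descFactorial i : ℂ))
    simp only [Matrix.of_apply] at h4
    rw [h4]
    exact mul_ne_zero (Finset.prod_ne_zero_iff.mpr fun j _ => leadingCoeff_ne_zero.mpr (hf j))
      (det_descFactorial_ne_zero _ hinj)
  have hne : wronskianDet f ≠ 0 := by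
    rintro h
    rw [h] at h2
    simp at h2
  refine ⟨hne, ?_⟩
  have h5 : (X ^ (∑ j : Fin r, (j : ℕ)) * wronskianDet f).natDegree ≤ N := by
    rw [h1, Matrix.det_apply']
    refine natDegree_sum_le_of_forall_le _ _ fun σ _ => ?_
    rw [← C_eq_intCast]
    refine (natDegree_C_mul_le _ _).trans ((natDegree_prod_le _ _).trans ?_)
    exact Finset.sum_le_sum fun j _ => natDegree_X_pow_mul_iterate_derivative_le _ _
  have h6 := le_antisymm h5 (le_natDegree_of_ne_zero h2)
  rw [natDegree_X_pow_mul _ hne] at h6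
  exact h6

/-! ### Integration of residue-free fractions and reduction of degrees -/

lemma exists_derivative_eq (q : ℂ[X]) : ∃ h : ℂ[X], derivative h = q := by
  induction q using Polynomial.induction_on' with
  | add a b ha hb =>
    obtain ⟨u, hu⟩ := ha
    obtain ⟨v, hv⟩ := hb
    exact ⟨u + v, by rw [derivative_add, hu, hv]⟩
  | monomial n a =>
    refine ⟨monomial (n + 1) (a / (n + 1)), ?_⟩
    rw [derivative_monomial, Nat.add_sub_cancel]
    congr 1
    push_cast
    field_simp

lemma isCoprime_of_noCommonRoots {f g : ℂ[X]} (h : NoCommonRoots f g) : IsCoprime f g := by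
  rw [isCoprime_iff_aeval_ne_zero_of_isAlgClosed ℂ ℂ]
  intro a
  by_contra hc
  push Not at hc
  exact h a (by simpa using hc)

lemma dvd_of_forall_isRoot {y g : ℂ[X]} (hy : ∀ a, y.IsRoot a → (derivative y).eval a ≠ 0)
    (hg : ∀ a, y.IsRoot a → g.IsRoot a) : y ∣ g := by
  have hsep : y.Separable := isCoprime_of_noCommonRoots fun a ha => hy a ha.1 ha.2
  by_cases hg0 : g = 0
  · rw [hg0]
    exact dvd_zero _
  refine (IsAlgClosed.splits y).dvd_of_roots_le_roots hsep.ne_zero ?_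
  rw [Multiset.le_iff_subset (nodup_roots hsep)]
  intro a ha
  rw [mem_roots hg0]
  exact hg a (isRoot_of_mem_roots ha)

/-- The equation `y u' - y' u = F` has a polynomial solution `u` when the residues of `F / y ^ 2`
vanish. -/
lemma exists_mul_derivative_sub_eq {y F : ℂ[X]}
    (hy : ∀ a, y.IsRoot a → (derivative y).eval a ≠ 0)
    (hF : ∀ a, y.IsRoot a →
      (derivative (derivative y) * F).eval a = (derivative y * derivative F).eval a) :
    ∃ u, y * derivative u - derivative y * u = F := by
  obtain ⟨s, t, hst⟩ : IsCoprime y (derivative y) :=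
    isCoprime_of_noCommonRoots fun a ha => hy a ha.1 ha.2
  -- This `v` solves the equation modulo `y`, since `-y' v = t y' F = F - s y F`.
  set v := -(t * F) with hv
  have h1 : F - (y * derivative v - derivative y * v) = y * (s * F - derivative v) := by
    have : F = (s * y + t * derivative y) * F := by rw [hst, one_mul]
    linear_combination this + derivative y * hv
  set G := s * F - derivative v with hG
  -- Differentiating `h1` at a root of `y` and inserting the residue condition gives `y'^2 G = 0`
  -- there.
  obtain ⟨H, hH⟩ : y ∣ G := by
    refine dvd_of_forall_isRoot hy fun a ha => ?_
    have h2 := congrArg (fun q => (derivative q).eval a) h1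
    have h0 := congrArg (fun q => q.eval a) h1
    have ha' : y.eval a = 0 := ha
    simp only [derivative_sub, derivative_mul, eval_sub, eval_add, eval_mul, ha'] at h0 h2
    have h3 := hF a ha
    simp only [eval_mul] at h3
    have h4 : (derivative y).eval a ^ 2 * G.eval a = 0 := by
      linear_combination (-(derivative y).eval a) * h2 - h3 + (derivative (derivative y)).eval a * h0
    exact (mul_eq_zero.mp h4).resolve_left (pow_ne_zero 2 (hy a ha))
  -- Adding `y h` to `v` changes `y v' - y' v` by `y^2 h'`, and the remaining error is `y^2 H`.
  obtain ⟨h, hh⟩ := exists_derivative_eq H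
  refine ⟨v + y * h, ?_⟩
  rw [hH] at h1
  simp only [derivative_add, derivative_mul, hh]
  linear_combination -h1

/-- Take an element of least degree in the coset of `g`: were its degree that of some `f j`,
subtracting a multiple of `f j` would lower it. It may be zero. -/
lemma exists_sub_mem_span_degree_ne {r : ℕ} (f : Fin r → ℂ[X]) (hf : ∀ j, f j ≠ 0) (g : ℂ[X]) :
    ∃ g', g - g' ∈ Submodule.span ℂ (Set.range f) ∧ ∀ j, g'.degree ≠ (f j).degree := by
  obtain ⟨g', hg', hmin⟩ := WellFounded.has_min (r := fun a b : ℂ[X] => a.degree < b.degree)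
    (InvImage.wf degree wellFounded_lt) {g' | g - g' ∈ Submodule.span ℂ (Set.range f)}
    ⟨g, by simp⟩
  refine ⟨g', hg', fun j hj => ?_⟩
  have hg0 : g' ≠ 0 := by
    rw [← degree_ne_bot, hj, degree_ne_bot]
    exact hf j
  refine hmin (g' - (g'.leadingCoeff / (f j).leadingCoeff) • f j) ?_ ?_
  · have hm : f j ∈ Submodule.span ℂ (Set.range f) := Submodule.subset_span ⟨j, rfl⟩
    have := Submodule.add_mem _ hg'
      (Submodule.smul_mem _ (g'.leadingCoeff / (f j).leadingCoeff) hm)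
    rw [Set.mem_ofPred_eq]
    convert! this using 1
    ring
  · have hlc : (f j).leadingCoeff ≠ 0 := leadingCoeff_ne_zero.mpr (hf j)
    have hlc' : g'.leadingCoeff ≠ 0 := leadingCoeff_ne_zero.mpr hg0
    have hq : g'.leadingCoeff / (f j).leadingCoeff ≠ 0 := div_ne_zero hlc' hlc
    refine degree_sub_lt_left ?_ hg0 ?_
    · rw [smul_eq_C_mul, degree_C_mul hq, hj]
    · rw [smul_eq_C_mul, leadingCoeff_mul, leadingCoeff_C]
      field_simp

lemma associated_iff_eq_C_mul {a b : ℂ[X]} : Associated a b ↔ ∃ c : ℂ, c ≠ 0 ∧ b = C c * a := by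
  constructor
  · rintro ⟨u, hu⟩
    obtain ⟨c, hc, h⟩ := Polynomial.isUnit_iff.mp u.isUnit
    exact ⟨c, hc.ne_zero, by rw [← hu, ← h, mul_comm]⟩
  · rintro ⟨c, hc, rfl⟩
    exact (associated_unit_mul_left a (C c) (isUnit_C.mpr hc.isUnit)).symm

lemma Associated.isRoot_iff {a b : ℂ[X]} (h : Associated a b) (x : ℂ) :
    a.IsRoot x ↔ b.IsRoot x := by
  obtain ⟨c, hc, rfl⟩ := associated_iff_eq_C_mul.mp h
  simp [hc]

lemma Associated.noCommonRoots {a b a' b' : ℂ[X]} (ha : Associated a a') (hb : Associated b b')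
    (h : NoCommonRoots a b) : NoCommonRoots a' b' := fun x hx =>
  h x ⟨(ha.isRoot_iff x).mpr hx.1, (hb.isRoot_iff x).mpr hx.2⟩

lemma Associated.natDegree_eq {a b : ℂ[X]} (h : Associated a b) : a.natDegree = b.natDegree := by
  obtain ⟨c, hc, rfl⟩ := associated_iff_eq_C_mul.mp h
  rw [natDegree_C_mul hc]

lemma associated_of_eq_C_mul {a b : ℂ[X]} {c : ℂ} (h : b = C c * a) (hb : b ≠ 0) :
    Associated a b := by
  refine associated_iff_eq_C_mul.mpr ⟨c, ?_, h⟩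
  rintro rfl
  exact hb (by rw [h]; simp)

/-! ### Flags of spans and their Wronskians -/

/-- The span of the first `r` terms of a sequence. -/
noncomputable def spanLT (f : ℕ → ℂ[X]) (r : ℕ) : Submodule ℂ ℂ[X] :=
  Submodule.span ℂ (f '' Set.Iio r)

lemma range_fin_eq_image (f : ℕ → ℂ[X]) (r : ℕ) :
    Set.range (fun j : Fin r => f j) = f '' Set.Iio r := by
  ext q
  constructor
  · rintro ⟨j, rfl⟩
    exact ⟨j, j.isLt, rfl⟩
  · rintro ⟨j, hj, rfl⟩
    exact ⟨⟨j, hj⟩, rfl⟩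

lemma spanLT_eq (f : ℕ → ℂ[X]) (r : ℕ) :
    spanLT f r = Submodule.span ℂ (Set.range fun j : Fin r => f j) := by
  rw [range_fin_eq_image]
  rfl

lemma mem_spanLT (f : ℕ → ℂ[X]) {j r : ℕ} (h : j < r) : f j ∈ spanLT f r :=
  Submodule.subset_span ⟨j, h, rfl⟩

lemma spanLT_mono (f : ℕ → ℂ[X]) {r s : ℕ} (h : r ≤ s) : spanLT f r ≤ spanLT f s :=
  Submodule.span_mono (Set.image_mono (Set.Iio_subset_Iio h))

lemma spanLT_congr {f g : ℕ → ℂ[X]} {r : ℕ} (h : ∀ j < r, f j = g j) : spanLT f r = spanLT g r := by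
  unfold spanLT
  congr 1
  exact Set.image_congr fun j hj => h j hj

lemma spanLT_succ (f : ℕ → ℂ[X]) (r : ℕ) :
    spanLT f (r + 1) = Submodule.span ℂ (insert (f r) (f '' Set.Iio r)) := by
  rw [spanLT, ← Set.image_insert_eq]
  congr 2
  ext j
  simp

lemma wr_eq_C_mul {f g : ℕ → ℂ[X]} {r : ℕ} (h : ∀ j < r, g j ∈ spanLT f r) :
    ∃ c : ℂ, wr g r = C c * wr f r :=
  wronskianDet_eq_C_mul fun j => by
    rw [← spanLT_eq]
    exact h j j.isLt

/-- Replacing the last function by one with the same class modulo the preceding functions. -/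
lemma wr_update_eq_C_mul {f : ℕ → ℂ[X]} {r : ℕ} {g g' : ℂ[X]} (h : g - g' ∈ spanLT f r) :
    ∃ c : ℂ, wr (Function.update f r g) (r + 1) = C c * wr (Function.update f r g') (r + 1) := by
  have hle : spanLT f r ≤ spanLT (Function.update f r g') (r + 1) := by
    rw [spanLT_congr (g := Function.update f r g') fun j hj => by simp [hj.ne]]
    exact spanLT_mono _ r.le_succ
  refine wr_eq_C_mul fun j hj => ?_
  rcases Nat.lt_succ_iff_lt_or_eq.mp hj with hj | rfl
  · rw [Function.update_of_ne hj.ne]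
    exact hle (mem_spanLT f hj)
  · rw [Function.update_self, ← sub_add_cancel g g']
    refine Submodule.add_mem _ (hle h) ?_
    have := mem_spanLT (Function.update f j g') j.lt_succ_self
    rwa [Function.update_self] at this

/-- The first `r` terms are nonzero, of pairwise distinct degrees. -/
def DistinctDegrees (f : ℕ → ℂ[X]) (r : ℕ) : Prop :=
  (∀ j < r, f j ≠ 0) ∧ ∀ i < r, ∀ j < r, (f i).natDegree = (f j).natDegree → i = j

lemma DistinctDegrees.mono {f : ℕ → ℂ[X]} {r s : ℕ} (h : DistinctDegrees f s) (hrs : r ≤ s) :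
    DistinctDegrees f r :=
  ⟨fun j hj => h.1 j (hj.trans_le hrs),
    fun i hi j hj => h.2 i (hi.trans_le hrs) j (hj.trans_le hrs)⟩

lemma DistinctDegrees.wr_natDegree {f : ℕ → ℂ[X]} {r : ℕ} (h : DistinctDegrees f r) :
    wr f r ≠ 0 ∧ (wr f r).natDegree + ∑ j : Fin r, (j : ℕ) = ∑ j : Fin r, (f j).natDegree :=
  wronskianDet_natDegree _ (fun j => h.1 j j.isLt)
    fun i j hij => Fin.ext (h.2 i i.isLt j j.isLt hij)

lemma DistinctDegrees.update {f : ℕ → ℂ[X]} {r : ℕ} (h : DistinctDegrees f r) {g : ℂ[X]}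
    (hg : g ≠ 0) (hd : ∀ j < r, g.degree ≠ (f j).degree) :
    DistinctDegrees (Function.update f r g) (r + 1) := by
  have hd' : ∀ j < r, g.natDegree ≠ (f j).natDegree := fun j hj he => hd j hj (by
    rw [degree_eq_natDegree hg, degree_eq_natDegree (h.1 j hj), he])
  constructor
  · intro j hj
    rcases Nat.lt_succ_iff_lt_or_eq.mp hj with hj | rfl
    · rw [Function.update_of_ne hj.ne]
      exact h.1 j hj
    · rwa [Function.update_self]
  · intro i hi j hj hij
    rcases Nat.lt_succ_iff_lt_or_eq.mp hi with hi | rfl <;>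
      rcases Nat.lt_succ_iff_lt_or_eq.mp hj with hj | rfl
    · rw [Function.update_of_ne hi.ne, Function.update_of_ne hj.ne] at hij
      exact h.2 i hi j hj hij
    · rw [Function.update_of_ne hi.ne, Function.update_self] at hij
      exact absurd hij.symm (hd' i hi)
    · rw [Function.update_of_ne hj.ne, Function.update_self] at hij
      exact absurd hij (hd' j hj)
    · rfl

lemma exists_sub_mem_spanLT_degree_ne {f : ℕ → ℂ[X]} {r : ℕ} (h : DistinctDegrees f r)
    (g : ℂ[X]) : ∃ g', g - g' ∈ spanLT f r ∧ ∀ j < r, g'.degree ≠ (f j).degree := by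
  obtain ⟨g', h1, h2⟩ := exists_sub_mem_span_degree_ne (fun j : Fin r => f j)
    (fun j => h.1 j j.isLt) g
  exact ⟨g', by rwa [spanLT_eq], fun j hj => h2 ⟨j, hj⟩⟩

/-- A function annihilated by the Wronskian with given functions is a combination of them. -/
lemma mem_spanLT_of_wr_eq_zero {f : ℕ → ℂ[X]} {r : ℕ} (h : DistinctDegrees f r) {g : ℂ[X]}
    (hg : wr (Function.update f r g) (r + 1) = 0) : g ∈ spanLT f r := by
  -- If the reduced representative `g'` were nonzero, its degree would be new, and the degree
  -- formula would make the Wronskian nonzero.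
  obtain ⟨g', h1, h2⟩ := exists_sub_mem_spanLT_degree_ne h g
  by_cases h0 : g' = 0
  · rwa [h0, sub_zero] at h1
  · obtain ⟨c, hc⟩ := wr_update_eq_C_mul (f := f) (r := r) (g := g') (g' := g)
      (by rw [← neg_sub]; exact Submodule.neg_mem _ h1)
    rw [hg, mul_zero] at hc
    exact absurd hc (h.update h0 h2).wr_natDegree.1

/-- The functions are determined by their Wronskians up to combinations of the preceding ones. -/
lemma mem_spanLT_of_associated_wr {f g : ℕ → ℂ[X]} {p : ℕ} (hf : DistinctDegrees f p)
    (hg : DistinctDegrees g p) (h : ∀ r ≤ p, Associated (wr f r) (wr g r)) :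
    ∀ r < p, g r ∈ spanLT f (r + 1) := by
  intro r
  induction r using Nat.strong_induction_on with
  | _ r ih =>
    intro hr
    have h0 := (hf.mono hr.le).wr_natDegree.1
    -- By induction the earlier `g j` lie in the span of the first `r` terms of `f`, so `g` may be
    -- traded for `f` in all places but the last.
    obtain ⟨c, hc⟩ : ∃ c : ℂ, wr g (r + 1) = C c * wr (Function.update f r (g r)) (r + 1) := by
      refine wr_eq_C_mul fun j hj => ?_
      rcases Nat.lt_succ_iff_lt_or_eq.mp hj with hj | rfl
      · have h1 := spanLT_mono f (show j + 1 ≤ r by omega) (ih j hj (hj.trans hr))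
        rw [spanLT_congr (g := Function.update f r (g r)) fun j hj => by simp [hj.ne]] at h1
        exact spanLT_mono _ r.le_succ h1
      · have := mem_spanLT (Function.update f j (g j)) j.lt_succ_self
        rwa [Function.update_self] at this
    have h1 := associated_of_eq_C_mul hc (hg.mono hr).wr_natDegree.1
    obtain ⟨b, -, hb⟩ := associated_iff_eq_C_mul.mp ((h (r + 1) hr).trans h1.symm)
    -- The two Wronskians of length `r + 1` are proportional, so the left side vanishes, and with it
    -- the Wronskian of `f 0, …, f r, g r`.
    have h2 := wronskian_wr f (g r) r h0
    rw [hb, derivative_C_mul] at h2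
    refine mem_spanLT_of_wr_eq_zero (hf.mono hr) ((mul_eq_zero.mp (?_ : wr f r * _ = 0)).resolve_left h0)
    rw [← h2]
    ring

lemma spanLT_le_of_associated_wr {f g : ℕ → ℂ[X]} {p : ℕ} (hf : DistinctDegrees f p)
    (hg : DistinctDegrees g p) (h : ∀ r ≤ p, Associated (wr f r) (wr g r)) :
    spanLT g p ≤ spanLT f p := by
  refine Submodule.span_le.mpr ?_
  rintro _ ⟨r, hr, rfl⟩
  exact spanLT_mono f hr (mem_spanLT_of_associated_wr hf hg h r hr)

/-- With strictly increasing degrees leading terms cannot cancel. Thus degrees alone single out the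
flag inside the whole span. -/
lemma mem_spanLT_of_degree_lt {f : ℕ → ℂ[X]} {e : ℕ → ℕ} {s : ℕ}
    (hf : ∀ j < s, (f j).degree = e j) (he : ∀ i j, i < j → j < s → e i < e j) {g : ℂ[X]}
    (hg : g ∈ spanLT f s) {r : ℕ} (hrs : r < s) (hd : g.degree < e r) : g ∈ spanLT f r := by
  induction s generalizing g with
  | zero => omega
  | succ s ih =>
    rw [spanLT_succ, Submodule.mem_span_insert] at hg
    obtain ⟨c, h, hh, rfl⟩ := hg
    have hle : spanLT f s ≤ degreeLT ℂ (e s) := by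
      refine Submodule.span_le.mpr ?_
      rintro _ ⟨j, hj, rfl⟩
      rw [Set.mem_Iio] at hj
      rw [SetLike.mem_coe, mem_degreeLT, hf j (hj.trans s.lt_succ_self)]
      exact_mod_cast he j s hj s.lt_succ_self
    have hres : e r ≤ e s := by
      rcases (Nat.lt_succ_iff.mp hrs).lt_or_eq with h | h
      · exact (he r s h s.lt_succ_self).le
      · rw [h]
    have h1 : (c • f s + h).coeff (e s) = 0 :=
      coeff_eq_zero_of_degree_lt (hd.trans_le (by exact_mod_cast hres))
    rw [coeff_add, coeff_smul, coeff_eq_zero_of_degree_lt (mem_degreeLT.mp (hle hh)), add_zero,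
      smul_eq_mul] at h1
    have h2 := hf s s.lt_succ_self
    have h3 : (f s).coeff (e s) ≠ 0 := by
      have h4 : (f s).natDegree = e s := natDegree_eq_of_degree_eq_some h2
      rw [← h4, coeff_natDegree, leadingCoeff_ne_zero, ← degree_ne_bot, h2]
      exact WithBot.coe_ne_bot
    have hc := (mul_eq_zero.mp h1).resolve_right h3
    rw [hc, zero_smul, zero_add] at hd ⊢
    rcases (Nat.lt_succ_iff.mp hrs).lt_or_eq with hr | hr
    · exact ih (fun j hj => hf j (hj.trans s.lt_succ_self))
        (fun i j hij hj => he i j hij (hj.trans s.lt_succ_self)) hh hr hd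
    · rwa [hr]

lemma distinctDegrees_of_degree_eq {f : ℕ → ℂ[X]} {e : ℕ → ℕ} {p : ℕ}
    (hf : ∀ j < p, (f j).degree = e j) (he : ∀ i j, i < j → j < p → e i < e j) :
    DistinctDegrees f p := by
  constructor
  · intro j hj
    rw [← degree_ne_bot, hf j hj]
    exact WithBot.coe_ne_bot
  · intro i hi j hj hij
    rw [natDegree_eq_of_degree_eq_some (hf i hi), natDegree_eq_of_degree_eq_some (hf j hj)] at hij
    rcases lt_trichotomy i j with h | h | h
    · exact absurd hij (he i j h hj).ne
    · exact h
    · exact absurd hij (he j i h hi).ne'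

/-- The Wronskians of a basis of prescribed degrees depend only on the plane. -/
lemma associated_wr_of_spanLT_eq {f g : ℕ → ℂ[X]} {e : ℕ → ℕ} {p : ℕ}
    (hf : ∀ j < p, (f j).degree = e j) (hg : ∀ j < p, (g j).degree = e j)
    (he : ∀ i j, i < j → j < p → e i < e j) (h : spanLT f p = spanLT g p) {r : ℕ} (hr : r ≤ p) :
    Associated (wr f r) (wr g r) := by
  have h1 : ∀ j < r, g j ∈ spanLT f r := by
    intro j hj
    have h2 : g j ∈ spanLT f p := by
      rw [h]
      exact mem_spanLT g (hj.trans_le hr)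
    rcases hr.lt_or_eq with hr' | rfl
    · refine mem_spanLT_of_degree_lt hf he h2 hr' ?_
      rw [hg j (hj.trans hr')]
      exact_mod_cast he j r hj hr'
    · exact h2
  obtain ⟨c, hc⟩ := wr_eq_C_mul h1
  exact associated_of_eq_C_mul hc
    ((distinctDegrees_of_degree_eq hg he).mono hr).wr_natDegree.1

/-! ### Bethe equations for tuples of polynomials -/

/-- The residues of `F / y ^ 2` at the simple roots of `y` vanish. -/
def ResidueFree (y F : ℂ[X]) : Prop :=
  ∀ a, y.IsRoot a → (derivative (derivative y) * F).eval a = (derivative y * derivative F).eval a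

lemma ResidueFree.of_associated {y F y' F' : ℂ[X]} (h : ResidueFree y F) (hy : Associated y y')
    (hF : Associated F F') : ResidueFree y' F' := by
  obtain ⟨c, hc, rfl⟩ := associated_iff_eq_C_mul.mp hy
  obtain ⟨b, hb, rfl⟩ := associated_iff_eq_C_mul.mp hF
  intro a ha
  have := h a ((hy.isRoot_iff a).mpr ha)
  simp only [derivative_C_mul, eval_mul, eval_C] at this ⊢
  linear_combination (c * b) * this

/-- The polynomials `1 = Y 0, Y 1, …, Y p` satisfy the Bethe equations at the roots of
`Y 1, …, Y (p - 1)`. -/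
structure IsBetheTuple (p : ℕ) (Y : ℕ → ℂ[X]) : Prop where
  zero : Associated 1 (Y 0)
  ne_zero : ∀ j ≤ p, Y j ≠ 0
  simple : ∀ j, j + 1 < p → ∀ a, (Y (j + 1)).IsRoot a → (derivative (Y (j + 1))).eval a ≠ 0
  noCommonRoots : ∀ j < p, NoCommonRoots (Y j) (Y (j + 1))
  residueFree : ∀ j, j + 1 < p → ResidueFree (Y (j + 1)) (Y j * Y (j + 2))

lemma IsBetheTuple.of_associated {p : ℕ} {Y Y' : ℕ → ℂ[X]} (h : IsBetheTuple p Y)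
    (hY : ∀ j ≤ p, Associated (Y j) (Y' j)) : IsBetheTuple p Y' where
  zero := h.zero.trans (hY 0 p.zero_le)
  ne_zero j hj := (hY j hj).ne_zero_iff.mp (h.ne_zero j hj)
  simple j hj a ha := by
    have h1 := hY (j + 1) hj.le
    have h2 := h.simple j hj a ((h1.isRoot_iff a).mpr ha)
    obtain ⟨c, hc, h3⟩ := associated_iff_eq_C_mul.mp h1
    rw [h3, derivative_C_mul, eval_mul, eval_C]
    exact mul_ne_zero hc h2
  noCommonRoots j hj := (hY j hj.le).noCommonRoots (hY (j + 1) hj) (h.noCommonRoots j hj)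
  residueFree j hj := (h.residueFree j hj).of_associated (hY (j + 1) hj.le)
    ((hY j (by omega)).mul_mul (hY (j + 2) hj))

/-- The Wronskians of a nondegenerate plane satisfy the Bethe equations. -/
lemma isBetheTuple_wr {p : ℕ} {f : ℕ → ℂ[X]} (hf : DistinctDegrees f p)
    (h : ∀ j < p, NoCommonRoots (wr f j) (wr f (j + 1))) : IsBetheTuple p (wr f) := by
  -- Here `B` is the Wronskian of `f 0, …, f (j - 1), f (j + 1)`. Thus `Y j * Y (j + 2) / Y (j + 1)
  -- ^ 2` is the derivative of `B / Y (j + 1)`.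
  have key : ∀ j, j + 1 < p → ∃ B, wr f (j + 1) * derivative B - derivative (wr f (j + 1)) * B =
      wr f j * wr f (j + 2) := fun j hj => ⟨wr (Function.update f j (f (j + 1))) (j + 1), by
    rw [wronskian_wr f _ j (hf.mono (by omega)).wr_natDegree.1, Function.update_eq_self]⟩
  refine ⟨by rw [wr_zero], fun j hj => (hf.mono hj).wr_natDegree.1, fun j hj a ha h0 => ?_, h,
    fun j hj a ha => ?_⟩
  -- At a multiple root of `Y (j + 1)` the left side vanishes, which forces a common root with `Y j`
  -- or `Y (j + 2)`.
  · obtain ⟨B, hB⟩ := key j hj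
    have h1 := congrArg (fun q => q.eval a) hB
    have ha' : (wr f (j + 1)).eval a = 0 := ha
    simp only [eval_sub, eval_mul, ha', h0, zero_mul, sub_zero] at h1
    rcases mul_eq_zero.mp h1.symm with h2 | h2
    · exact h j (by omega) a ⟨h2, ha⟩
    · exact h (j + 1) hj a ⟨ha, h2⟩
  · obtain ⟨B, hB⟩ := key j hj
    have ha' : (wr f (j + 1)).eval a = 0 := ha
    rw [← hB]
    simp only [derivative_sub, derivative_mul, eval_sub, eval_add, eval_mul, ha']
    ring

/-- Inverts the operator that sends `g` to its Wronskian with the first `j` functions. Each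
integration removes one function, by `wronskian_wr`, until only `g` itself is left. -/
lemma IsBetheTuple.exists_wr_update {p : ℕ} {Y : ℕ → ℂ[X]} (hY : IsBetheTuple p Y) (f : ℕ → ℂ[X])
    (j : ℕ) (hj : j < p) (hf : ∀ i ≤ j, Associated (wr f i) (Y i)) (u : ℂ[X])
    (hu : ∀ i, j = i + 1 → ResidueFree (Y j) (Y i * u)) :
    ∃ g, Associated (wr (Function.update f j g) (j + 1)) u := by
  induction j generalizing u with
  | zero =>
    refine ⟨u, ?_⟩
    have : wr (Function.update f 0 u) 1 = u := by
      simp [wr, wronskianDet]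
    rw [this]
  | succ j ih =>
    obtain ⟨v, hv⟩ := exists_mul_derivative_sub_eq (hY.simple j hj) (hu j rfl)
    -- The primitive `v` inherits the residue condition one level down: at a root of `Y (i + 1)` the
    -- equation says `Y (i + 2) v' = Y (i + 2)' v`, so `v` can replace `Y (i + 2)` in the Bethe
    -- equation.
    obtain ⟨g, hg⟩ := ih (by omega) (fun i hi => hf i (by omega)) v (by
      rintro i rfl a ha
      have h1 := hY.residueFree i (by omega) a ha
      have h2 := congrArg (fun q => q.eval a) hv
      have h3 : (Y (i + 1 + 1)).eval a ≠ 0 := fun h => hY.noCommonRoots (i + 1) (by omega) a ⟨ha, h⟩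
      have ha' : (Y (i + 1)).eval a = 0 := ha
      simp only [eval_sub, eval_mul, ha', zero_mul] at h2
      refine mul_left_cancel₀ h3 ?_
      simp only [derivative_mul, eval_add, eval_mul] at h1 ⊢
      linear_combination (v.eval a) * h1 -
        ((derivative (Y (i + 1))).eval a * (Y i).eval a) * h2)
    refine ⟨g, ?_⟩
    obtain ⟨b, hb, h1⟩ := associated_iff_eq_C_mul.mp (hf (j + 1) le_rfl).symm
    obtain ⟨c, hc, h2⟩ := associated_iff_eq_C_mul.mp hg.symm
    obtain ⟨d, hd, h3⟩ := associated_iff_eq_C_mul.mp (hf j (by omega)).symm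
    have h0 : Y j ≠ 0 := hY.ne_zero j (by omega)
    have h4 := wronskian_wr f g j (by
      rw [h3]
      exact mul_ne_zero (C_ne_zero.mpr hd) h0)
    rw [h1, h2, h3, derivative_C_mul, derivative_C_mul] at h4
    refine (associated_iff_eq_C_mul.mpr ⟨d⁻¹ * (b * c), by positivity, ?_⟩ : Associated u _).symm
    refine mul_left_cancel₀ (mul_ne_zero (C_ne_zero.mpr hd) h0) ?_
    rw [← h4]
    have h5 : (C d : ℂ[X]) * C d⁻¹ = 1 := by rw [← C_mul, mul_inv_cancel₀ hd, C_1]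
    simp only [C_mul]
    linear_combination (C b * C c) * hv - (Y j * C b * C c * u) * h5

lemma ne_zero_of_wr_update_ne_zero {f : ℕ → ℂ[X]} {r : ℕ} {g : ℂ[X]}
    (h : wr (Function.update f r g) (r + 1) ≠ 0) : g ≠ 0 := by
  rintro rfl
  refine h (Matrix.det_eq_zero_of_column_eq_zero (Fin.last r) fun i => ?_)
  simp

/-- Every solution of the Bethe equations comes from a plane. -/
lemma IsBetheTuple.exists_sequence {p : ℕ} {Y : ℕ → ℂ[X]} (hY : IsBetheTuple p Y) {e : ℕ → ℕ}
    (he : ∀ j < p, e j + (Y j).natDegree = (Y (j + 1)).natDegree + j)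
    (hmono : ∀ i j, i < j → j < p → e i < e j) :
    ∃ f : ℕ → ℂ[X], (∀ j < p, (f j).degree = e j) ∧ ∀ j ≤ p, Associated (wr f j) (Y j) := by
  suffices H : ∀ r ≤ p, ∃ f : ℕ → ℂ[X], (∀ j < r, (f j).degree = e j) ∧
      ∀ j ≤ r, Associated (wr f j) (Y j) from H p le_rfl
  intro r
  induction r with
  | zero =>
    intro _
    refine ⟨0, by simp, fun j hj => ?_⟩
    rw [Nat.le_zero.mp hj, wr_zero]
    exact hY.zero
  | succ r ih =>
    intro hr
    obtain ⟨f, hd, hf⟩ := ih (by omega)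
    have hdd : DistinctDegrees f r :=
      distinctDegrees_of_degree_eq hd fun i j hij hj => hmono i j hij (by omega)
    obtain ⟨g, hg⟩ := hY.exists_wr_update f r hr hf (Y (r + 1)) (by
      rintro i rfl
      exact hY.residueFree i hr)
    obtain ⟨g', h1, h2⟩ := exists_sub_mem_spanLT_degree_ne hdd g
    obtain ⟨c, hc⟩ := wr_update_eq_C_mul h1
    have hne : wr (Function.update f r g) (r + 1) ≠ 0 :=
      hg.ne_zero_iff.mpr (hY.ne_zero (r + 1) hr)
    have h3 := associated_of_eq_C_mul hc hne
    have h4 := ne_zero_of_wr_update_ne_zero (h3.ne_zero_iff.mpr hne)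
    -- Subtracting the degree formulas for lengths `r + 1` and `r` isolates the degree of `g'`,
    -- which `he` identifies as `e r`.
    have h5 := (hdd.update h4 h2).wr_natDegree.2
    have h6 := hdd.wr_natDegree.2
    rw [Fin.sum_univ_castSucc, Fin.sum_univ_castSucc, (h3.trans hg).natDegree_eq] at h5
    have h7 : ∀ j : Fin r, Function.update f r g' (j : ℕ) = f j := fun j =>
      Function.update_of_ne j.isLt.ne _ _
    simp only [h7, Fin.val_castSucc, Fin.val_last, Function.update_self] at h5
    rw [(hf r le_rfl).natDegree_eq] at h6
    have h8 := he r hr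
    refine ⟨Function.update f r g', fun j hj => ?_, fun j hj => ?_⟩
    · rcases Nat.lt_succ_iff_lt_or_eq.mp hj with hj | rfl
      · rw [Function.update_of_ne hj.ne]
        exact hd j hj
      · rw [Function.update_self, degree_eq_natDegree h4]
        congr 1
        omega
    · rcases hj.lt_or_eq with hj | rfl
      · rw [wr_congr (g := f) fun i hi => Function.update_of_ne (by omega) _ _]
        exact hf j (by omega)
      · exact h3.trans hg

/-! ### Critical points of the master function -/

/-- `f` does not vanish at `x`, and its logarithmic derivative there is `L`. -/
def HasLogFDerivAt {E : Type*} [NormedAddCommGroup E] [NormedSpace ℂ E] (f : E → ℂ)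
    (L : E →L[ℂ] ℂ) (x : E) : Prop :=
  f x ≠ 0 ∧ HasFDerivAt f (f x • L) x

section HasLogFDerivAt

variable {E : Type*} [NormedAddCommGroup E] [NormedSpace ℂ E] {f g : E → ℂ} {L M : E →L[ℂ] ℂ}
  {x : E}

lemma HasLogFDerivAt.mul (hf : HasLogFDerivAt f L x) (hg : HasLogFDerivAt g M x) :
    HasLogFDerivAt (fun y => f y * g y) (L + M) x := by
  refine ⟨mul_ne_zero hf.1 hg.1, (hf.2.mul hg.2).congr_fderiv ?_⟩
  ext v
  simp
  ring

lemma HasLogFDerivAt.zpow (hf : HasLogFDerivAt f L x) (n : ℤ) :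
    HasLogFDerivAt (fun y => f y ^ n) ((n : ℂ) • L) x := by
  refine ⟨zpow_ne_zero n hf.1,
    ((hasDerivAt_zpow n (f x) (Or.inl hf.1)).comp_hasFDerivAt x hf.2).congr_fderiv ?_⟩
  ext v
  have : f x ^ n = f x ^ (n - 1) * f x := by
    rw [← zpow_add_one₀ hf.1, sub_add_cancel]
  simp only [smul_apply, smul_eq_mul, this]
  ring

lemma HasLogFDerivAt.pow (hf : HasLogFDerivAt f L x) (n : ℕ) :
    HasLogFDerivAt (fun y => f y ^ n) ((n : ℂ) • L) x := by
  simpa using hf.zpow n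

lemma HasLogFDerivAt.inv (hf : HasLogFDerivAt f L x) : HasLogFDerivAt (fun y => (f y)⁻¹) (-L) x := by
  have h : (((-1 : ℤ) : ℂ) • L) = -L := by
    ext v
    simp
  simpa only [zpow_neg_one, h] using hf.zpow (-1)

lemma HasLogFDerivAt.prod {ι : Type*} {s : Finset ι} {f : ι → E → ℂ} {L : ι → E →L[ℂ] ℂ}
    (h : ∀ i ∈ s, HasLogFDerivAt (f i) (L i) x) :
    HasLogFDerivAt (fun y => ∏ i ∈ s, f i y) (∑ i ∈ s, L i) x := by
  classical
  induction s using Finset.induction_on with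
  | empty => exact ⟨by simp, by simpa using hasFDerivAt_const (1 : ℂ) x⟩
  | insert a s ha ih =>
    simp only [Finset.prod_insert ha, Finset.sum_insert ha]
    exact (h a (Finset.mem_insert_self a s)).mul
      (ih fun i hi => h i (Finset.mem_insert_of_mem hi))

lemma HasLogFDerivAt.fderiv_eq_zero_iff (h : HasLogFDerivAt f L x) : fderiv ℂ f x = 0 ↔ L = 0 := by
  rw [h.2.fderiv]
  refine ⟨fun h0 => ?_, fun h0 => ?_⟩
  · ext v
    have h1 : f x * L v = 0 := DFunLike.congr_fun h0 v
    simpa [h.1] using h1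
  · ext v
    simp [h0]

end HasLogFDerivAt

/-- The logarithmic differential of the coordinate difference `t a - t b`. -/
noncomputable def logDifferential {ι : Type*} [Fintype ι] (t : ι → ℂ) (a b : ι) : (ι → ℂ) →L[ℂ] ℂ :=
  (t a - t b)⁻¹ • ((ContinuousLinearMap.proj a : (ι → ℂ) →L[ℂ] ℂ) - ContinuousLinearMap.proj b)

lemma hasLogFDerivAt_sub {ι : Type*} [Fintype ι] {t : ι → ℂ} (a b : ι) (h : t a ≠ t b) :
    HasLogFDerivAt (fun s : ι → ℂ => s a - s b) (logDifferential t a b) t := by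
  unfold logDifferential
  refine ⟨sub_ne_zero.mpr h, ?_⟩
  rw [smul_smul, mul_inv_cancel₀ (sub_ne_zero.mpr h), one_smul]
  exact (hasFDerivAt_apply a t).sub (hasFDerivAt_apply b t)

lemma hasLogFDerivAt_sub_const {ι : Type*} [Fintype ι] {t : ι → ℂ} (a : ι) (c : ℂ) (h : t a ≠ c) :
    HasLogFDerivAt (fun s : ι → ℂ => s a - c) ((t a - c)⁻¹ •
      (ContinuousLinearMap.proj a : (ι → ℂ) →L[ℂ] ℂ)) t := by
  refine ⟨sub_ne_zero.mpr h, ?_⟩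
  rw [smul_smul, mul_inv_cancel₀ (sub_ne_zero.mpr h), one_smul]
  exact (hasFDerivAt_apply a t).sub_const c

/-- Each unordered pair accounts for both of its orderings. -/
lemma sum_sum_Ioi_add {κ : ℕ} (g : Fin κ → Fin κ → ℂ) :
    ∑ i, ∑ j ∈ Finset.Ioi i, (g i j + g j i) = ∑ i, ∑ j ∈ Finset.univ.erase i, g i j := by
  have h1 : ∑ i, ∑ j ∈ Finset.Ioi i, g j i = ∑ i, ∑ j ∈ Finset.Iio i, g i j :=
    Finset.sum_comm' (by simp)
  simp only [Finset.sum_add_distrib]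
  rw [h1, ← Finset.sum_add_distrib]
  refine Finset.sum_congr rfl fun i _ => ?_
  rw [← Finset.sum_union]
  · refine Finset.sum_congr ?_ fun _ _ => rfl
    ext j
    simp only [Finset.mem_union, Finset.mem_Ioi, Finset.mem_Iio, Finset.mem_erase, Finset.mem_univ,
      and_true]
    rw [or_comm]
    exact lt_or_lt_iff_ne
  · rw [Finset.disjoint_left]
    intro j hj hj'
    exact lt_asymm (Finset.mem_Ioi.mp hj) (Finset.mem_Iio.mp hj')

/-- The logarithmic partial derivative of the master function. -/
noncomputable def betheExpression {p n : ℕ} (z : Fin n → ℂ) (m : Fin n → ℕ)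
    (k : Fin (p - 1) → ℕ) (t : VarIndex k → ℂ) (b : VarIndex k) : ℂ :=
  (∑ j ∈ Finset.univ.erase b.2, 2 * (t b - t ⟨b.1, j⟩)⁻¹) -
  (∑ l' ∈ Finset.univ.filter (fun l' : Fin (p - 1) => (l' : ℕ) = (b.1 : ℕ) + 1),
    ∑ j : Fin (k l'), (t b - t ⟨l', j⟩)⁻¹) -
  (∑ l' ∈ Finset.univ.filter (fun l' : Fin (p - 1) => (b.1 : ℕ) = (l' : ℕ) + 1),
    ∑ j : Fin (k l'), (t b - t ⟨l', j⟩)⁻¹) -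
  (if (b.1 : ℕ) = 0 then ∑ j : Fin n, m j * (t b - z j)⁻¹ else 0)

/-- Logarithmic derivatives of products add up. The sum keeps the shape of the product, so that
applied to `v` it becomes the left side of `sum_mul_betheExpression`. -/
lemma hasLogFDerivAt_masterFunction {p n : ℕ} (z : Fin n → ℂ) (m : Fin n → ℕ)
    (k : Fin (p - 1) → ℕ) {t : VarIndex k → ℂ} (ht : t ∈ masterDomain z k) :
    HasLogFDerivAt (masterFunction z m k)
      ((∑ l : Fin (p - 1), ∑ i : Fin (k l), ∑ j ∈ Finset.Ioi i,
          ((2 : ℕ) : ℂ) • logDifferential t (⟨l, i⟩ : VarIndex k) ⟨l, j⟩) +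
        (∑ l : Fin (p - 1),
          ∑ l' ∈ Finset.univ.filter (fun l' : Fin (p - 1) => (l' : ℕ) = (l : ℕ) + 1),
          ∑ i : Fin (k l), ∑ j : Fin (k l'),
            -logDifferential t (⟨l, i⟩ : VarIndex k) ⟨l', j⟩) +
        ∑ l ∈ Finset.univ.filter (fun l : Fin (p - 1) => (l : ℕ) = 0),
          ∑ j : Fin n, ∑ i : Fin (k l), ((-(m j : ℤ) : ℤ) : ℂ) • ((t ⟨l, i⟩ - z j)⁻¹ •
            (ContinuousLinearMap.proj (⟨l, i⟩ : VarIndex k) : (VarIndex k → ℂ) →L[ℂ] ℂ))) t := by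
  obtain ⟨h1, h2, h3⟩ := ht
  unfold masterFunction
  refine HasLogFDerivAt.mul (HasLogFDerivAt.mul ?_ ?_) ?_
  · refine HasLogFDerivAt.prod fun l _ => HasLogFDerivAt.prod fun i _ =>
      HasLogFDerivAt.prod fun j hj => HasLogFDerivAt.pow ?_ 2
    exact hasLogFDerivAt_sub _ _ (h1 l i j (Finset.mem_Ioi.mp hj).ne)
  · refine HasLogFDerivAt.prod fun l _ => HasLogFDerivAt.prod fun l' hl' =>
      HasLogFDerivAt.prod fun i _ => HasLogFDerivAt.prod fun j _ => HasLogFDerivAt.inv ?_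
    exact hasLogFDerivAt_sub _ _ (h2 l l' (Finset.mem_filter.mp hl').2 i j)
  · refine HasLogFDerivAt.prod fun l hl => HasLogFDerivAt.prod fun j _ =>
      HasLogFDerivAt.prod fun i _ => HasLogFDerivAt.zpow ?_ _
    exact hasLogFDerivAt_sub_const _ _ (h3 l (Finset.mem_filter.mp hl).2 i j)

/-- Collects the coefficient of each `v b`. A difference between consecutive groups contributes at
both of its ends, hence the two neighbour sums in `betheExpression`. -/
lemma sum_mul_betheExpression {p n : ℕ} (z : Fin n → ℂ) (m : Fin n → ℕ)
    (k : Fin (p - 1) → ℕ) (t v : VarIndex k → ℂ) :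
    (∑ l : Fin (p - 1), ∑ i : Fin (k l), ∑ j ∈ Finset.Ioi i,
        2 * ((t ⟨l, i⟩ - t ⟨l, j⟩)⁻¹ * (v ⟨l, i⟩ - v ⟨l, j⟩))) +
      (∑ l : Fin (p - 1),
        ∑ l' ∈ Finset.univ.filter (fun l' : Fin (p - 1) => (l' : ℕ) = (l : ℕ) + 1),
        ∑ i : Fin (k l), ∑ j : Fin (k l'),
          -((t ⟨l, i⟩ - t ⟨l', j⟩)⁻¹ * (v ⟨l, i⟩ - v ⟨l', j⟩))) +
      ∑ l ∈ Finset.univ.filter (fun l : Fin (p - 1) => (l : ℕ) = 0),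
        ∑ j : Fin n, ∑ i : Fin (k l), -(m j * ((t ⟨l, i⟩ - z j)⁻¹ * v ⟨l, i⟩)) =
    ∑ b, v b * betheExpression z m k t b := by
  have e1 : ∀ l : Fin (p - 1), (∑ i : Fin (k l), ∑ j ∈ Finset.Ioi i,
      2 * ((t ⟨l, i⟩ - t ⟨l, j⟩)⁻¹ * (v ⟨l, i⟩ - v ⟨l, j⟩))) =
      ∑ i : Fin (k l), v ⟨l, i⟩ *
        ∑ j ∈ Finset.univ.erase i, 2 * (t ⟨l, i⟩ - t ⟨l, j⟩)⁻¹ := by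
    intro l
    simp only [Finset.mul_sum]
    rw [← sum_sum_Ioi_add]
    refine Finset.sum_congr rfl fun i _ => Finset.sum_congr rfl fun j _ => ?_
    rw [← neg_sub (t ⟨l, i⟩) (t ⟨l, j⟩), inv_neg]
    ring
  have e2 : (∑ l : Fin (p - 1),
        ∑ l' ∈ Finset.univ.filter (fun l' : Fin (p - 1) => (l' : ℕ) = (l : ℕ) + 1),
        ∑ i : Fin (k l), ∑ j : Fin (k l'),
          -((t ⟨l, i⟩ - t ⟨l', j⟩)⁻¹ * (v ⟨l, i⟩ - v ⟨l', j⟩))) =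
      -(∑ l : Fin (p - 1), ∑ i : Fin (k l), v ⟨l, i⟩ *
        ∑ l' ∈ Finset.univ.filter (fun l' : Fin (p - 1) => (l' : ℕ) = (l : ℕ) + 1),
          ∑ j : Fin (k l'), (t ⟨l, i⟩ - t ⟨l', j⟩)⁻¹) -
      ∑ l : Fin (p - 1), ∑ i : Fin (k l), v ⟨l, i⟩ *
        ∑ l' ∈ Finset.univ.filter (fun l' : Fin (p - 1) => (l : ℕ) = (l' : ℕ) + 1),
          ∑ j : Fin (k l'), (t ⟨l, i⟩ - t ⟨l', j⟩)⁻¹ := by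
    have e3 : (∑ l : Fin (p - 1), ∑ i : Fin (k l), v ⟨l, i⟩ *
        ∑ l' ∈ Finset.univ.filter (fun l' : Fin (p - 1) => (l : ℕ) = (l' : ℕ) + 1),
          ∑ j : Fin (k l'), (t ⟨l, i⟩ - t ⟨l', j⟩)⁻¹) = ∑ l : Fin (p - 1),
        ∑ l' ∈ Finset.univ.filter (fun l' : Fin (p - 1) => (l' : ℕ) = (l : ℕ) + 1),
        ∑ i : Fin (k l), ∑ j : Fin (k l'), v ⟨l', j⟩ * (t ⟨l', j⟩ - t ⟨l, i⟩)⁻¹ := by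
      have : ∀ l : Fin (p - 1), (∑ i : Fin (k l), v ⟨l, i⟩ *
          ∑ l' ∈ Finset.univ.filter (fun l' : Fin (p - 1) => (l : ℕ) = (l' : ℕ) + 1),
            ∑ j : Fin (k l'), (t ⟨l, i⟩ - t ⟨l', j⟩)⁻¹) =
          ∑ l' ∈ Finset.univ.filter (fun l' : Fin (p - 1) => (l : ℕ) = (l' : ℕ) + 1),
            ∑ j : Fin (k l'), ∑ i : Fin (k l), v ⟨l, i⟩ * (t ⟨l, i⟩ - t ⟨l', j⟩)⁻¹ := by
        intro l
        simp only [Finset.mul_sum]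
        rw [Finset.sum_comm]
        exact Finset.sum_congr rfl fun l' _ => Finset.sum_comm
      rw [Finset.sum_congr rfl fun l _ => this l]
      exact Finset.sum_comm' (by simp)
    have e4 : (∑ l : Fin (p - 1), ∑ i : Fin (k l), v ⟨l, i⟩ *
        ∑ l' ∈ Finset.univ.filter (fun l' : Fin (p - 1) => (l' : ℕ) = (l : ℕ) + 1),
          ∑ j : Fin (k l'), (t ⟨l, i⟩ - t ⟨l', j⟩)⁻¹) = ∑ l : Fin (p - 1),
        ∑ l' ∈ Finset.univ.filter (fun l' : Fin (p - 1) => (l' : ℕ) = (l : ℕ) + 1),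
        ∑ i : Fin (k l), ∑ j : Fin (k l'), v ⟨l, i⟩ * (t ⟨l, i⟩ - t ⟨l', j⟩)⁻¹ := by
      refine Finset.sum_congr rfl fun l _ => ?_
      simp only [Finset.mul_sum]
      exact Finset.sum_comm
    rw [e3, e4]
    simp only [← Finset.sum_neg_distrib, ← Finset.sum_sub_distrib]
    refine Finset.sum_congr rfl fun l _ => Finset.sum_congr rfl fun l' _ =>
      Finset.sum_congr rfl fun i _ => Finset.sum_congr rfl fun j _ => ?_
    rw [← neg_sub (t ⟨l, i⟩) (t ⟨l', j⟩), inv_neg]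
    ring
  have e5 : (∑ l ∈ Finset.univ.filter (fun l : Fin (p - 1) => (l : ℕ) = 0),
        ∑ j : Fin n, ∑ i : Fin (k l), -(m j * ((t ⟨l, i⟩ - z j)⁻¹ * v ⟨l, i⟩))) =
      -∑ l : Fin (p - 1), ∑ i : Fin (k l), v ⟨l, i⟩ *
        if (l : ℕ) = 0 then ∑ j : Fin n, m j * (t ⟨l, i⟩ - z j)⁻¹ else 0 := by
    rw [Finset.sum_filter, ← Finset.sum_neg_distrib]
    refine Finset.sum_congr rfl fun l _ => ?_
    split_ifs
    · rw [Finset.sum_comm, ← Finset.sum_neg_distrib]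
      refine Finset.sum_congr rfl fun i _ => ?_
      rw [Finset.mul_sum, ← Finset.sum_neg_distrib]
      refine Finset.sum_congr rfl fun j _ => ?_
      ring
    · simp
  rw [Finset.sum_congr rfl fun l _ => e1 l, e2, e5, Fintype.sum_sigma]
  unfold betheExpression
  simp only [mul_sub, Finset.sum_sub_distrib]
  ring

lemma fderiv_masterFunction_eq_zero_iff {p n : ℕ} (z : Fin n → ℂ) (m : Fin n → ℕ)
    (k : Fin (p - 1) → ℕ) {t : VarIndex k → ℂ} (ht : t ∈ masterDomain z k) :
    fderiv ℂ (masterFunction z m k) t = 0 ↔ ∀ b, betheExpression z m k t b = 0 := by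
  obtain ⟨L, H, hL⟩ : ∃ L, HasLogFDerivAt (masterFunction z m k) L t ∧ L = _ :=
    ⟨_, hasLogFDerivAt_masterFunction z m k ht, rfl⟩
  have key : ∀ v, L v = ∑ b, v b * betheExpression z m k t b := by
    intro v
    rw [← sum_mul_betheExpression, hL]
    simp [logDifferential]
  rw [H.fderiv_eq_zero_iff]
  constructor
  · intro h b
    have := key (Pi.single b 1)
    rw [h] at this
    simpa [Pi.single_apply] using this.symm
  · intro h
    ext v
    simp [key, h]

/-! ### The polynomials attached to a point -/

/-- The monic polynomial whose roots are the variables of the `l`-th group. -/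
noncomputable def groupPolynomial {p : ℕ} (k : Fin (p - 1) → ℕ) (t : VarIndex k → ℂ)
    (l : Fin (p - 1)) : ℂ[X] :=
  ∏ i : Fin (k l), (X - C (t ⟨l, i⟩))

/-- The polynomials `y₀ = W, y₁, …, y_{p-1}, y_p = 1`. -/
noncomputable def pointPolynomial {p n : ℕ} (z : Fin n → ℂ) (m : Fin n → ℕ)
    (k : Fin (p - 1) → ℕ) (t : VarIndex k → ℂ) : ℕ → ℂ[X]
  | 0 => targetPolynomial z m
  | l + 1 => if h : l < p - 1 then groupPolynomial k t ⟨l, h⟩ else 1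

lemma eval_derivative_prod_X_sub_C_pow {ι : Type*} (s : Finset ι) (c : ι → ℂ) (e : ι → ℕ) (a : ℂ)
    (h : ∀ i ∈ s, a ≠ c i) :
    (derivative (∏ i ∈ s, (X - C (c i)) ^ e i)).eval a =
      (∏ i ∈ s, (X - C (c i)) ^ e i).eval a * ∑ i ∈ s, e i * (a - c i)⁻¹ := by
  classical
  induction s using Finset.induction_on with
  | empty => simp
  | insert i s hi ih =>
    have h1 := ih fun j hj => h j (Finset.mem_insert_of_mem hj)
    have h2 : a - c i ≠ 0 := sub_ne_zero.mpr (h i (Finset.mem_insert_self i s))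
    rw [Finset.prod_insert hi, Finset.sum_insert hi, derivative_mul, eval_add, eval_mul, eval_mul,
      eval_mul, h1, derivative_X_sub_C_pow]
    have h3 : ((C (e i : ℂ) * (X - C (c i)) ^ (e i - 1)).eval a) =
        ((X - C (c i)) ^ e i).eval a * (e i * (a - c i)⁻¹) := by
      -- The exponent `e i - 1` is truncated when `e i = 0`; there both sides vanish.
      rcases Nat.eq_zero_or_pos (e i) with h0 | h0
      · simp [h0]
      · obtain ⟨d, hd⟩ := Nat.exists_eq_succ_of_ne_zero h0.ne'
        simp only [hd, eval_mul, eval_C, eval_pow, eval_sub, eval_X, Nat.succ_eq_add_one,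
          Nat.add_sub_cancel, pow_succ]
        field_simp
    rw [h3]
    ring

lemma eval_derivative_prod_X_sub_C {ι : Type*} (s : Finset ι) (c : ι → ℂ) (a : ℂ)
    (h : ∀ i ∈ s, a ≠ c i) :
    (derivative (∏ i ∈ s, (X - C (c i)))).eval a =
      (∏ i ∈ s, (X - C (c i))).eval a * ∑ i ∈ s, (a - c i)⁻¹ := by
  simpa using eval_derivative_prod_X_sub_C_pow s c (fun _ => 1) a h

/-- The neighbour sums have at most one term; an absent neighbour matches the value `1` of
`pointPolynomial`. -/
lemma sum_filter_val_eq {N : ℕ} (F : Fin N → ℂ) (c : ℕ) :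
    ∑ l ∈ Finset.univ.filter (fun l : Fin N => (l : ℕ) = c), F l =
      if h : c < N then F ⟨c, h⟩ else 0 := by
  rw [Finset.sum_filter]
  split_ifs with h
  · rw [Finset.sum_eq_single ⟨c, h⟩]
    · simp
    · intro l _ hl
      rw [if_neg fun h' => hl (Fin.ext h')]
    · simp
  · refine Finset.sum_eq_zero fun l _ => ?_
    rw [if_neg]
    have := l.isLt
    omega

/-! ### Critical points as solutions of the Bethe equations -/

section Point

variable {p n : ℕ} (z : Fin n → ℂ) (m : Fin n → ℕ) (k : Fin (p - 1) → ℕ) (t : VarIndex k → ℂ)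

lemma pointPolynomial_succ (l : Fin (p - 1)) :
    pointPolynomial z m k t (l + 1) = groupPolynomial k t l := by
  simp [pointPolynomial]

lemma pointPolynomial_of_le {l : ℕ} (hp : 0 < p) (h : p ≤ l) : pointPolynomial z m k t l = 1 := by
  obtain ⟨l, rfl⟩ := Nat.exists_eq_succ_of_ne_zero (show l ≠ 0 by omega)
  simp only [pointPolynomial]
  rw [dif_neg (by omega)]

lemma pointPolynomial_monic (l : ℕ) : (pointPolynomial z m k t l).Monic := by
  rcases l with _ | l
  · simp only [pointPolynomial, targetPolynomial]
    exact monic_prod_of_monic _ _ fun j _ => (monic_X_sub_C _).pow _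
  · simp only [pointPolynomial]
    split_ifs
    · exact monic_prod_of_monic _ _ fun j _ => monic_X_sub_C _
    · exact monic_one

lemma pointPolynomial_natDegree (l : ℕ) :
    (pointPolynomial z m k t l).natDegree = extendedK m k l := by
  rcases l with _ | l
  · simp only [pointPolynomial, targetPolynomial, extendedK]
    rw [natDegree_prod_of_monic _ _ fun j _ => (monic_X_sub_C _).pow _]
    simp
  · simp only [pointPolynomial, extendedK]
    split_ifs
    · simp only [groupPolynomial]
      rw [natDegree_prod_of_monic _ _ fun j _ => monic_X_sub_C _]
      simp
    · simp

lemma isRoot_groupPolynomial_iff (l : Fin (p - 1)) (a : ℂ) :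
    (groupPolynomial k t l).IsRoot a ↔ ∃ i, a = t ⟨l, i⟩ := by
  simp [groupPolynomial, IsRoot.def, eval_prod, Finset.prod_eq_zero_iff, sub_eq_zero]

lemma isRoot_targetPolynomial_iff (hm : ∀ j, 0 < m j) (a : ℂ) :
    (targetPolynomial z m).IsRoot a ↔ ∃ j, a = z j := by
  simp only [targetPolynomial, IsRoot.def, eval_prod, Finset.prod_eq_zero_iff, Finset.mem_univ,
    true_and, eval_pow, eval_sub, eval_X, eval_C]
  refine exists_congr fun j => ?_
  rw [pow_eq_zero_iff (hm j).ne', sub_eq_zero]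

lemma groupPolynomial_eq_mul (b : VarIndex k) : groupPolynomial k t b.1 =
    (X - C (t b)) * ∏ j ∈ Finset.univ.erase b.2, (X - C (t ⟨b.1, j⟩)) :=
  (Finset.mul_prod_erase _ _ (Finset.mem_univ b.2)).symm

lemma eval_derivative_groupPolynomial (b : VarIndex k) :
    (derivative (groupPolynomial k t b.1)).eval (t b) =
      (∏ j ∈ Finset.univ.erase b.2, (X - C (t ⟨b.1, j⟩))).eval (t b) := by
  rw [groupPolynomial_eq_mul]
  simp [derivative_mul]

lemma groupPolynomial_simple_iff (l : Fin (p - 1)) :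
    (∀ a, (groupPolynomial k t l).IsRoot a → (derivative (groupPolynomial k t l)).eval a ≠ 0) ↔
      ∀ i j : Fin (k l), i ≠ j → t ⟨l, i⟩ ≠ t ⟨l, j⟩ := by
  constructor
  · intro h i j hij he
    refine h (t ⟨l, i⟩) ((isRoot_groupPolynomial_iff k t l _).mpr ⟨i, rfl⟩) ?_
    rw [eval_derivative_groupPolynomial k t ⟨l, i⟩, eval_prod]
    refine Finset.prod_eq_zero (Finset.mem_erase.mpr ⟨hij.symm, Finset.mem_univ j⟩) ?_
    simp [he]
  · intro h a ha
    obtain ⟨i, rfl⟩ := (isRoot_groupPolynomial_iff k t l _).mp ha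
    rw [eval_derivative_groupPolynomial k t ⟨l, i⟩, eval_prod, Finset.prod_ne_zero_iff]
    intro j hj
    simpa [sub_eq_zero] using h i j (Finset.ne_of_mem_erase hj).symm

variable {t}

/-- Group `l` is encoded by the polynomial of index `l + 1`, so its neighbours have indices `l` and
`l + 2`. -/
lemma pointPolynomial_succ_succ_logDeriv (ht : t ∈ masterDomain z k) (b : VarIndex k) :
    (pointPolynomial z m k t (b.1 + 2)).eval (t b) ≠ 0 ∧
    (derivative (pointPolynomial z m k t (b.1 + 2))).eval (t b) =
      (pointPolynomial z m k t (b.1 + 2)).eval (t b) *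
      ∑ l' ∈ Finset.univ.filter (fun l' : Fin (p - 1) => (l' : ℕ) = (b.1 : ℕ) + 1),
        ∑ j : Fin (k l'), (t b - t ⟨l', j⟩)⁻¹ := by
  rw [sum_filter_val_eq]
  simp only [pointPolynomial]
  split_ifs with h
  · have h1 := ht.2.1 b.1 ⟨b.1 + 1, h⟩ rfl b.2
    refine ⟨fun h0 => ?_, eval_derivative_prod_X_sub_C _ _ _ fun j _ => h1 j⟩
    obtain ⟨j, hj⟩ := (isRoot_groupPolynomial_iff k t _ _).mp h0
    exact h1 j hj
  · simp

/-- Only one summand is present: the lower neighbour is `W` for the first group and a group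
polynomial otherwise. -/
lemma pointPolynomial_logDeriv (hm : ∀ j, 0 < m j) (ht : t ∈ masterDomain z k) (b : VarIndex k) :
    (pointPolynomial z m k t b.1).eval (t b) ≠ 0 ∧
    (derivative (pointPolynomial z m k t b.1)).eval (t b) =
      (pointPolynomial z m k t b.1).eval (t b) *
      ((∑ l' ∈ Finset.univ.filter (fun l' : Fin (p - 1) => (b.1 : ℕ) = (l' : ℕ) + 1),
        ∑ j : Fin (k l'), (t b - t ⟨l', j⟩)⁻¹) +
        (if (b.1 : ℕ) = 0 then ∑ j : Fin n, m j * (t b - z j)⁻¹ else 0)) := by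
  rcases Nat.eq_zero_or_pos (b.1 : ℕ) with h | h
  · have h1 := ht.2.2 b.1 h b.2
    rw [if_pos h, Finset.filter_false_of_mem (by intro l' _; omega), Finset.sum_empty, zero_add]
    have h2 : pointPolynomial z m k t b.1 = targetPolynomial z m := by
      rw [h]
      rfl
    rw [h2]
    refine ⟨fun h0 => ?_, eval_derivative_prod_X_sub_C_pow _ _ _ _ fun j _ => h1 j⟩
    obtain ⟨j, hj⟩ := (isRoot_targetPolynomial_iff z m hm _).mp h0
    exact h1 j hj
  · have hb := b.1.isLt
    have hlt : (b.1 : ℕ) - 1 < p - 1 := by omega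
    have h1 := fun j => (ht.2.1 ⟨b.1 - 1, hlt⟩ b.1 (Nat.sub_add_cancel h).symm j b.2).symm
    have hfilter : Finset.univ.filter (fun l' : Fin (p - 1) => (b.1 : ℕ) = (l' : ℕ) + 1) =
        Finset.univ.filter fun l' : Fin (p - 1) => (l' : ℕ) = (b.1 : ℕ) - 1 := by
      ext l'
      simp only [Finset.mem_filter, Finset.mem_univ, true_and]
      omega
    rw [if_neg h.ne', add_zero, hfilter, sum_filter_val_eq, dif_pos hlt]
    have h2 : pointPolynomial z m k t b.1 = groupPolynomial k t ⟨b.1 - 1, hlt⟩ := by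
      rw [← pointPolynomial_succ z m]
      congr 1
      exact (Nat.sub_add_cancel h).symm
    rw [h2]
    refine ⟨fun h0 => ?_, eval_derivative_prod_X_sub_C _ _ _ fun j _ => h1 j⟩
    obtain ⟨j, hj⟩ := (isRoot_groupPolynomial_iff k t _ _).mp h0
    exact h1 j hj

/-- Writing `y = (x - a) Q` gives `y'(a) = Q(a)` and `y''(a) = 2 Q'(a)`. The residue condition at
`a` is then the Bethe expression times `y'` and the two neighbouring polynomials, all nonzero at
`a`. -/
lemma residueFree_pointPolynomial_iff (hm : ∀ j, 0 < m j) (ht : t ∈ masterDomain z k)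
    (l : Fin (p - 1)) :
    ResidueFree (pointPolynomial z m k t (l + 1))
      (pointPolynomial z m k t l * pointPolynomial z m k t (l + 2)) ↔
    ∀ i, betheExpression z m k t ⟨l, i⟩ = 0 := by
  have key : ∀ i : Fin (k l), ((derivative (derivative (groupPolynomial k t l)) *
      (pointPolynomial z m k t l * pointPolynomial z m k t (l + 2))).eval (t ⟨l, i⟩) =
      (derivative (groupPolynomial k t l) * derivative
        (pointPolynomial z m k t l * pointPolynomial z m k t (l + 2))).eval (t ⟨l, i⟩)) ↔
      betheExpression z m k t ⟨l, i⟩ = 0 := by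
    intro i
    obtain ⟨h1, h2⟩ := pointPolynomial_succ_succ_logDeriv z m k ht ⟨l, i⟩
    obtain ⟨h3, h4⟩ := pointPolynomial_logDeriv z m k hm ht ⟨l, i⟩
    have h5 : (derivative (groupPolynomial k t l)).eval (t ⟨l, i⟩) ≠ 0 :=
      (groupPolynomial_simple_iff k t l).mpr (ht.1 l) _
        ((isRoot_groupPolynomial_iff k t l _).mpr ⟨i, rfl⟩)
    have h6 : (derivative (derivative (groupPolynomial k t l))).eval (t ⟨l, i⟩) =
        (derivative (groupPolynomial k t l)).eval (t ⟨l, i⟩) *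
          ∑ j ∈ Finset.univ.erase i, 2 * (t ⟨l, i⟩ - t ⟨l, j⟩)⁻¹ := by
      rw [eval_derivative_groupPolynomial k t ⟨l, i⟩, groupPolynomial_eq_mul k t ⟨l, i⟩,
        ← Finset.mul_sum]
      have h7 := eval_derivative_prod_X_sub_C (Finset.univ.erase i) (fun j => t ⟨l, j⟩) (t ⟨l, i⟩)
        fun j hj => ht.1 l i j (Finset.ne_of_mem_erase hj).symm
      simp only [derivative_mul, derivative_add, derivative_sub, derivative_X, derivative_C,
        sub_zero, zero_mul, one_mul, eval_add, eval_mul, eval_sub, eval_X,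
        eval_C, sub_self, add_zero]
      linear_combination 2 * h7
    rw [← sub_eq_zero]
    have h8 : (derivative (derivative (groupPolynomial k t l)) *
        (pointPolynomial z m k t l * pointPolynomial z m k t (l + 2))).eval (t ⟨l, i⟩) -
        (derivative (groupPolynomial k t l) * derivative
        (pointPolynomial z m k t l * pointPolynomial z m k t (l + 2))).eval (t ⟨l, i⟩) =
        ((derivative (groupPolynomial k t l)).eval (t ⟨l, i⟩) *
          (pointPolynomial z m k t l).eval (t ⟨l, i⟩) *
          (pointPolynomial z m k t (l + 2)).eval (t ⟨l, i⟩)) * betheExpression z m k t ⟨l, i⟩ := by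
      simp only [derivative_mul, eval_add, eval_mul]
      rw [h2, h4, h6]
      unfold betheExpression
      ring
    rw [h8, mul_eq_zero_iff_left (mul_ne_zero (mul_ne_zero h5 h3) h1)]
  rw [pointPolynomial_succ]
  constructor
  · intro h i
    exact (key i).mp (h _ ((isRoot_groupPolynomial_iff k t l _).mpr ⟨i, rfl⟩))
  · intro h a ha
    obtain ⟨i, rfl⟩ := (isRoot_groupPolynomial_iff k t l _).mp ha
    exact (key i).mpr (h i)

lemma noCommonRoots_pointPolynomial_iff (l l' : Fin (p - 1)) :
    NoCommonRoots (pointPolynomial z m k t (l + 1)) (pointPolynomial z m k t (l' + 1)) ↔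
      ∀ i j, t ⟨l, i⟩ ≠ t ⟨l', j⟩ := by
  rw [pointPolynomial_succ, pointPolynomial_succ]
  constructor
  · intro h i j he
    exact h _ ⟨(isRoot_groupPolynomial_iff k t l _).mpr ⟨i, rfl⟩,
      (isRoot_groupPolynomial_iff k t l' _).mpr ⟨j, he⟩⟩
  · rintro h a ⟨ha, ha'⟩
    obtain ⟨i, rfl⟩ := (isRoot_groupPolynomial_iff k t l _).mp ha
    obtain ⟨j, hj⟩ := (isRoot_groupPolynomial_iff k t l' _).mp ha'
    exact h i j hj

lemma noCommonRoots_pointPolynomial_zero_iff (hm : ∀ j, 0 < m j) (l : Fin (p - 1)) :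
    NoCommonRoots (pointPolynomial z m k t 0) (pointPolynomial z m k t (l + 1)) ↔
      ∀ i j, t ⟨l, i⟩ ≠ z j := by
  rw [pointPolynomial_succ]
  constructor
  · intro h i j he
    exact h _ ⟨(isRoot_targetPolynomial_iff z m hm _).mpr ⟨j, he⟩,
      (isRoot_groupPolynomial_iff k t l _).mpr ⟨i, rfl⟩⟩
  · rintro h a ⟨ha, ha'⟩
    obtain ⟨i, rfl⟩ := (isRoot_groupPolynomial_iff k t l _).mp ha'
    obtain ⟨j, hj⟩ := (isRoot_targetPolynomial_iff z m hm _).mp ha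
    exact h i j hj

lemma mem_masterDomain_iff (hp : 2 ≤ p) (hm : ∀ j, 0 < m j) : t ∈ masterDomain z k ↔
    (∀ (l : Fin (p - 1)) (i j : Fin (k l)), i ≠ j → t ⟨l, i⟩ ≠ t ⟨l, j⟩) ∧
      ∀ l, l + 1 < p →
        NoCommonRoots (pointPolynomial z m k t l) (pointPolynomial z m k t (l + 1)) := by
  refine and_congr_right fun _ => ⟨?_, ?_⟩
  · rintro ⟨h1, h2⟩ l hl
    rcases l with _ | l
    · exact (noCommonRoots_pointPolynomial_zero_iff z m k hm ⟨0, by omega⟩).mpr (h2 _ rfl)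
    · exact (noCommonRoots_pointPolynomial_iff z m k ⟨l, by omega⟩ ⟨l + 1, by omega⟩).mpr
        (h1 _ _ rfl)
  · intro h
    constructor
    · intro l l' hl'
      refine (noCommonRoots_pointPolynomial_iff z m k l l').mp ?_
      rw [hl']
      exact h _ (by have := l'.isLt; omega)
    · intro l hl
      refine (noCommonRoots_pointPolynomial_zero_iff z m k hm l).mp ?_
      rw [hl]
      exact h 0 (by omega)

lemma mem_configurationSpace_iff (hp : 2 ≤ p) (hm : ∀ j, 0 < m j) : t ∈ configurationSpace z k ↔
    t ∈ masterDomain z k ∧ ∀ l l' : ℕ, l < l' → l' < p →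
      NoCommonRoots (pointPolynomial z m k t l) (pointPolynomial z m k t l') := by
  constructor
  · rintro ⟨h1, h2⟩
    refine ⟨⟨fun l i j hij he => hij ?_, fun l l' hl' i j he => ?_, fun l _ i j => h2 _ j⟩, ?_⟩
    · simpa using h1 he
    · have := congrArg (fun b : VarIndex k => (b.1 : ℕ)) (h1 he)
      simp only at this
      omega
    · intro l l' hl hl'
      obtain ⟨l', rfl⟩ := Nat.exists_eq_succ_of_ne_zero (show l' ≠ 0 by omega)
      rcases l with _ | l
      · exact (noCommonRoots_pointPolynomial_zero_iff z m k hm ⟨l', by omega⟩).mpr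
          fun i j => h2 _ j
      · refine (noCommonRoots_pointPolynomial_iff z m k ⟨l, by omega⟩ ⟨l', by omega⟩).mpr
          fun i j he => ?_
        have := congrArg (fun b : VarIndex k => (b.1 : ℕ)) (h1 he)
        simp only at this
        omega
  · rintro ⟨⟨h1, -, -⟩, h2⟩
    constructor
    · rintro ⟨l, i⟩ ⟨l', j⟩ he
      rcases lt_trichotomy (l : ℕ) l' with h | h | h
      · exact absurd he ((noCommonRoots_pointPolynomial_iff z m k l l').mp
          (h2 _ _ (by omega) (by have := l'.isLt; omega)) i j)
      · obtain rfl := Fin.ext h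
        by_contra hne
        exact h1 l i j (fun h' => hne (by rw [h'])) he
      · exact absurd he.symm ((noCommonRoots_pointPolynomial_iff z m k l' l).mp
          (h2 _ _ (by omega) (by have := l.isLt; omega)) j i)
    · rintro ⟨l, i⟩ j
      exact (noCommonRoots_pointPolynomial_zero_iff z m k hm l).mp
        (h2 _ _ (by omega) (by have := l.isLt; omega)) i j

lemma noCommonRoots_one_right (q : ℂ[X]) : NoCommonRoots q 1 := fun x hx => by
  simpa using hx.2

lemma NoCommonRoots.symm {f g : ℂ[X]} (h : NoCommonRoots f g) : NoCommonRoots g f :=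
  fun x hx => h x hx.symm

/-- Critical points of the master function are the solutions of the Bethe equations. -/
lemma mem_criticalPoints_iff (hp : 2 ≤ p) (hm : ∀ j, 0 < m j) :
    t ∈ criticalPoints z m k (masterDomain z k) ↔
      IsBetheTuple p fun j => pointPolynomial z m k t (p - j) := by
  constructor
  · rintro ⟨h1, h2⟩
    rw [fderiv_masterFunction_eq_zero_iff z m k h1] at h2
    obtain ⟨h3, h4⟩ := (mem_masterDomain_iff z m k hp hm).mp h1
    have hidx : ∀ j, j + 1 < p → ∃ l : Fin (p - 1), p - j = l + 2 ∧ p - (j + 1) = l + 1 ∧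
        p - (j + 2) = l := fun j hj => ⟨⟨p - j - 2, by omega⟩, by simp; omega, by simp; omega,
          by simp; omega⟩
    refine ⟨?_, fun j _ => (pointPolynomial_monic z m k t _).ne_zero, fun j hj => ?_,
      fun j hj => ?_, fun j hj => ?_⟩
    · rw [pointPolynomial_of_le z m k t (by omega) (by omega)]
    · obtain ⟨l, -, e, -⟩ := hidx j hj
      rw [e, pointPolynomial_succ]
      exact (groupPolynomial_simple_iff k t l).mpr (h3 l)
    -- The domain says nothing about the pair `y_p`, `y_{p-1}`, but `y_p = 1`.
    · rcases Nat.eq_zero_or_pos j with rfl | h0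
      · have := pointPolynomial_of_le z m k t (l := p - 0) (by omega) (by omega)
        rw [this]
        exact (noCommonRoots_one_right _).symm
      · have := h4 (p - (j + 1)) (by omega)
        rw [show p - (j + 1) + 1 = p - j by omega] at this
        exact this.symm
    · obtain ⟨l, e1, e2, e3⟩ := hidx j hj
      simp only [e1, e2, e3]
      rw [mul_comm]
      exact (residueFree_pointPolynomial_iff z m k hm h1 l).mpr fun i => h2 _
  · intro h
    have hidx : ∀ l : Fin (p - 1), ∃ j, j + 1 < p ∧ p - j = l + 2 ∧ p - (j + 1) = l + 1 ∧
        p - (j + 2) = l := fun l => ⟨p - l - 2, by omega, by omega, by omega, by omega⟩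
    have h1 : t ∈ masterDomain z k := by
      refine (mem_masterDomain_iff z m k hp hm).mpr ⟨fun l => ?_, fun l hl => ?_⟩
      · obtain ⟨j, hj, -, e, -⟩ := hidx l
        have := h.simple j hj
        rw [e, pointPolynomial_succ] at this
        exact (groupPolynomial_simple_iff k t l).mp this
      · have := h.noCommonRoots (p - (l + 1)) (by omega)
        rw [show p - (p - (l + 1)) = l + 1 by omega, show p - (p - (l + 1) + 1) = l by omega]
          at this
        exact this.symm
    refine ⟨h1, (fderiv_masterFunction_eq_zero_iff z m k h1).mpr ?_⟩
    rintro ⟨l, i⟩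
    obtain ⟨j, hj, e1, e2, e3⟩ := hidx l
    have := h.residueFree j hj
    simp only [e1, e2, e3] at this
    rw [mul_comm] at this
    exact (residueFree_pointPolynomial_iff z m k hm h1 l).mp this i

end Point

/-! ### Polynomials and their root tuples -/

/-- Equal multisets of values mean fibres of equal size; bijections of the fibres glue to `σ`. -/
lemma exists_perm_of_map_univ_eq {N : ℕ} {f g : Fin N → ℂ}
    (h : Finset.univ.val.map f = Finset.univ.val.map g) :
    ∃ σ : Equiv.Perm (Fin N), ∀ i, g i = f (σ i) := by
  have hcard : ∀ x, Fintype.card {i // g i = x} = Fintype.card {i // f i = x} := by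
    intro x
    have h1 := congrArg (Multiset.count x) h
    rw [Multiset.count_map, Multiset.count_map] at h1
    rw [Fintype.card_subtype, Fintype.card_subtype, Finset.card_def, Finset.card_def,
      Finset.filter_val, Finset.filter_val]
    simp only [eq_comm (a := x)] at h1
    exact h1.symm
  refine ⟨Equiv.ofFiberEquiv fun x => Fintype.equivOfCardEq (hcard x), fun i => ?_⟩
  exact (Equiv.ofFiberEquiv_map _ i).symm

lemma exists_associated_prod_X_sub_C {q : ℂ[X]} {N : ℕ} (hq : q ≠ 0) (hN : q.natDegree = N) :
    ∃ c : Fin N → ℂ, Associated q (∏ i, (X - C (c i))) := by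
  have hs := IsAlgClosed.splits q
  obtain ⟨L, hL⟩ := Quot.exists_rep q.roots
  have hlen : L.length = N := by
    rw [← hN, hs.natDegree_eq_card_roots, ← hL]
    rfl
  subst hlen
  refine ⟨fun i => L.get i, ?_⟩
  have h1 : ∏ i, (X - C (L.get i)) = (q.roots.map fun a => X - C a).prod := by
    rw [← hL]
    change _ = (L.map fun a => X - C a).prod
    rw [← List.prod_ofFn]
    congr 1
    refine List.ext_get (by simp) fun i h1 h2 => by simp
  rw [h1]
  exact (associated_of_eq_C_mul hs.eq_prod_roots hq).symm

/-! ### Bases of planes as sequences -/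

/-- The sequence `P_p, P_{p-1}, …, P_1`. -/
noncomputable def reversedSequence {p : ℕ} (P : Fin p → ℂ[X]) (j : ℕ) : ℂ[X] :=
  if h : j < p then P ⟨p - 1 - j, by omega⟩ else 0

/-- The sequence `d_p, d_{p-1}, …, d_1`. -/
def reversedDegrees {p : ℕ} (d : Fin p → ℕ) (j : ℕ) : ℕ :=
  if h : j < p then d ⟨p - 1 - j, by omega⟩ else 0

/-- Reversing the order of the functions changes the determinant only by a sign. -/
lemma associated_tailWronskian {p : ℕ} (P : Fin p → ℂ[X]) (l : ℕ) :
    Associated (tailWronskian P l) (wr (reversedSequence P) (p - l)) := by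
  have h : wr (reversedSequence P) (p - l) = ((Matrix.of fun i j : Fin (p - l) =>
      derivative^[(i : ℕ)] (P ⟨l + j, by have := j.isLt; omega⟩)).submatrix id Fin.revPerm).det := by
    unfold wr wronskianDet
    congr 1
    ext1 i j
    have hj := j.isLt
    simp only [Matrix.of_apply, Matrix.submatrix_apply, id_eq, reversedSequence,
      dif_pos (show (j : ℕ) < p by omega), Fin.revPerm_apply, Fin.val_rev]
    congr 3
    omega
  rw [h, Matrix.det_permute']
  refine (associated_unit_mul_left _ _ ?_).symm
  have := (Equiv.Perm.sign (Fin.revPerm (n := p - l))).isUnit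
  exact this.map (Int.castRingHom ℂ[X])

lemma tailWronskian_zero {p : ℕ} (P : Fin p → ℂ[X]) : tailWronskian P 0 = wronskianDet P := by
  unfold tailWronskian
  congr 1
  funext j
  congr 1
  exact Fin.ext (Nat.zero_add _)

lemma tailWronskian_self {p : ℕ} (P : Fin p → ℂ[X]) : Associated (tailWronskian P p) 1 := by
  have := associated_tailWronskian P p
  rwa [Nat.sub_self, wr_zero] at this

lemma spanLT_reversedSequence {p : ℕ} (P : Fin p → ℂ[X]) :
    spanLT (reversedSequence P) p = Submodule.span ℂ (Set.range P) := by
  unfold spanLT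
  congr 1
  ext q
  constructor
  · rintro ⟨j, hj, rfl⟩
    rw [Set.mem_Iio] at hj
    exact ⟨⟨p - 1 - j, by omega⟩, by simp [reversedSequence, hj]⟩
  · rintro ⟨j, rfl⟩
    have := j.isLt
    refine ⟨p - 1 - j, Set.mem_Iio.mpr (by omega), ?_⟩
    rw [reversedSequence, dif_pos (by omega)]
    congr 1
    exact Fin.ext (by simp only; omega)

lemma linearIndependent_of_wronskianDet_ne_zero {r : ℕ} {f : Fin r → ℂ[X]}
    (h : wronskianDet f ≠ 0) : LinearIndependent ℂ f := by
  rw [Fintype.linearIndependent_iff]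
  intro c hc i
  have h1 : (Matrix.of fun i j : Fin r => derivative^[(i : ℕ)] (f j)).mulVec (fun j => C (c j)) =
      0 := by
    funext i
    have h2 := congrArg (fun q => derivative^[(i : ℕ)] q) hc
    simp only [iterate_derivative_sum, iterate_derivative_smul, iterate_derivative_zero] at h2
    rw [Pi.zero_apply, ← h2]
    change ∑ j, derivative^[(i : ℕ)] (f j) * C (c j) = _
    simp only [smul_eq_C_mul, mul_comm]
  have h3 := congrFun (Matrix.eq_zero_of_mulVec_eq_zero h h1) i
  simpa using h3

lemma reversedDegrees_lt {p : ℕ} {d : Fin p → ℕ} (hd : StrictAnti d) (i j : ℕ) (hij : i < j)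
    (hj : j < p) : reversedDegrees d i < reversedDegrees d j := by
  rw [reversedDegrees, reversedDegrees, dif_pos (hij.trans hj), dif_pos hj]
  exact hd (by rw [Fin.mk_lt_mk]; omega)

lemma IsBasisOfDegrees.degree_reversedSequence {p : ℕ} {V : Submodule ℂ ℂ[X]} {d : Fin p → ℕ}
    {P : Fin p → ℂ[X]} (h : IsBasisOfDegrees V d P) (j : ℕ) (hj : j < p) :
    (reversedSequence P j).degree = reversedDegrees d j := by
  rw [reversedSequence, reversedDegrees, dif_pos hj, dif_pos hj]
  exact h.2.2 _

lemma IsBasisOfDegrees.distinctDegrees {p : ℕ} {V : Submodule ℂ ℂ[X]} {d : Fin p → ℕ}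
    (hd : StrictAnti d) {P : Fin p → ℂ[X]} (h : IsBasisOfDegrees V d P) :
    DistinctDegrees (reversedSequence P) p :=
  distinctDegrees_of_degree_eq h.degree_reversedSequence (reversedDegrees_lt hd)

lemma IsBasisOfDegrees.spanLT_eq {p : ℕ} {V : Submodule ℂ ℂ[X]} {d : Fin p → ℕ}
    {P : Fin p → ℂ[X]} (h : IsBasisOfDegrees V d P) : spanLT (reversedSequence P) p = V := by
  rw [spanLT_reversedSequence, h.2.1]

/-- Makes the nondegeneracy conditions independent of the chosen basis of degrees `d`. -/
lemma IsBasisOfDegrees.associated_tailWronskian {p : ℕ} {V : Submodule ℂ ℂ[X]} {d : Fin p → ℕ}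
    (hd : StrictAnti d) {P Q : Fin p → ℂ[X]} (hP : IsBasisOfDegrees V d P)
    (hQ : IsBasisOfDegrees V d Q) (l : ℕ) : Associated (tailWronskian P l) (tailWronskian Q l) := by
  refine (_root_.associated_tailWronskian P l).trans (Associated.trans ?_
    (_root_.associated_tailWronskian Q l).symm)
  exact associated_wr_of_spanLT_eq hP.degree_reversedSequence hQ.degree_reversedSequence
    (reversedDegrees_lt hd) (by rw [hP.spanLT_eq, hQ.spanLT_eq]) (Nat.sub_le _ _)

lemma IsBasisOfDegrees.isPlaneWithWronskian_iff {p : ℕ} {V : Submodule ℂ ℂ[X]} {d : Fin p → ℕ}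
    {P : Fin p → ℂ[X]} (h : IsBasisOfDegrees V d P) {w : ℂ[X]} (hw : w.Monic) :
    IsPlaneWithWronskian p V w ↔ Associated (tailWronskian P 0) w := by
  rw [tailWronskian_zero]
  constructor
  · rintro ⟨-, b, c, hc, hb⟩
    obtain ⟨c', hc'⟩ := wronskianDet_eq_C_mul (f := P) (g := fun i => (b i : ℂ[X])) fun j => by
      rw [h.2.1]
      exact (b j).2
    have hne : wronskianDet (fun i => (b i : ℂ[X])) ≠ 0 := by
      rw [hb]
      exact mul_ne_zero (C_ne_zero.mpr hc) hw.ne_zero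
    exact (associated_of_eq_C_mul hc' hne).trans (associated_of_eq_C_mul hb hne).symm
  · intro hP
    obtain ⟨c, hc, h1⟩ := associated_iff_eq_C_mul.mp hP.symm
    obtain ⟨h2, rfl, -⟩ := h
    refine ⟨hw, Module.Basis.span h2, c, hc, ?_⟩
    rw [← h1]
    congr 1
    funext i
    rw [Module.Basis.span_apply]

/-! ### The bijection between orbits and planes -/

section Main

variable {p n : ℕ} (z : Fin n → ℂ) (m : Fin n → ℕ) (k : Fin (p - 1) → ℕ) (d : Fin p → ℕ)

/-- The roots of the Wronskians of the plane `V` of type `d` are the coordinates of `t`. -/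
def Corresponds (t : VarIndex k → ℂ) (V : Submodule ℂ ℂ[X]) : Prop :=
  ∃ P : Fin p → ℂ[X], IsBasisOfDegrees V d P ∧
    ∀ l ≤ p, Associated (tailWronskian P l) (pointPolynomial z m k t l)

/-- The degrees of the members of a basis in terms of the numbers `k_l`. -/
def DegreeCondition : Prop :=
  ∀ l : Fin p, (d l : ℤ) =
    (extendedK m k l : ℤ) - (extendedK m k (l + 1) : ℤ) + ((p : ℤ) - ((l : ℤ) + 1))

variable {z m k d}

lemma DegreeCondition.reversedDegrees_add (hdk : DegreeCondition m k d) (j : ℕ) (hj : j < p) :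
    reversedDegrees d j + extendedK m k (p - j) = extendedK m k (p - (j + 1)) + j := by
  have h := hdk ⟨p - (j + 1), by omega⟩
  have e : (⟨p - 1 - j, by omega⟩ : Fin p) = ⟨p - (j + 1), by omega⟩ := Fin.ext (by simp only; omega)
  rw [reversedDegrees, dif_pos hj, e]
  simp only at h
  rw [show p - (j + 1) + 1 = p - j by omega] at h
  omega

lemma extendedK_self (hp : 0 < p) : extendedK m k p = 0 := by
  obtain ⟨q, rfl⟩ := Nat.exists_eq_succ_of_ne_zero hp.ne'
  simp [extendedK]

/-- The degrees `d` telescope to `k_l` plus the staircase `∑ j`, which the degree formula for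
Wronskians removes. -/
lemma IsBasisOfDegrees.natDegree_tailWronskian (hp : 0 < p) (hd : StrictAnti d)
    (hdk : DegreeCondition m k d) {V : Submodule ℂ ℂ[X]} {P : Fin p → ℂ[X]}
    (h : IsBasisOfDegrees V d P) {l : ℕ} (hl : l ≤ p) :
    tailWronskian P l ≠ 0 ∧ (tailWronskian P l).natDegree = extendedK m k l := by
  have h1 := _root_.associated_tailWronskian P l
  have h2 := ((h.distinctDegrees hd).mono (Nat.sub_le p l)).wr_natDegree
  refine ⟨h1.ne_zero_iff.mpr h2.1, ?_⟩
  have key : ∀ r ≤ p, ∑ j : Fin r, (reversedSequence P j).natDegree =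
      extendedK m k (p - r) + ∑ j : Fin r, (j : ℕ) := by
    intro r hr
    induction r with
    | zero => simp [extendedK_self hp]
    | succ r ih =>
      have h3 := hdk.reversedDegrees_add r hr
      have h4 := natDegree_eq_of_degree_eq_some (h.degree_reversedSequence r hr)
      have h5 := ih (by omega)
      rw [Fin.sum_univ_castSucc, Fin.sum_univ_castSucc]
      simp only [Fin.val_castSucc, Fin.val_last]
      omega
  have h3 := key (p - l) (Nat.sub_le _ _)
  rw [Nat.sub_sub_self hl] at h3
  rw [h1.natDegree_eq]
  omega

lemma noCommonRoots_tailWronskian_iff {t : VarIndex k → ℂ} {P : Fin p → ℂ[X]}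
    (hP : ∀ l ≤ p, Associated (tailWronskian P l) (pointPolynomial z m k t l)) {l l' : ℕ}
    (hl : l ≤ p) (hl' : l' ≤ p) : NoCommonRoots (tailWronskian P l) (tailWronskian P l') ↔
      NoCommonRoots (pointPolynomial z m k t l) (pointPolynomial z m k t l') :=
  ⟨(hP l hl).noCommonRoots (hP l' hl'), (hP l hl).symm.noCommonRoots (hP l' hl').symm⟩

lemma Corresponds.isPlaneWithWronskian {t : VarIndex k → ℂ} {V : Submodule ℂ ℂ[X]}
    (h : Corresponds z m k d t V) : IsPlaneWithWronskian p V (targetPolynomial z m) := by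
  obtain ⟨P, hP, h1⟩ := h
  exact (hP.isPlaneWithWronskian_iff (pointPolynomial_monic z m k t 0)).mpr (h1 0 p.zero_le)

lemma Corresponds.associated {t : VarIndex k → ℂ} {V : Submodule ℂ ℂ[X]} (hd : StrictAnti d)
    (h : Corresponds z m k d t V) {P : Fin p → ℂ[X]} (hP : IsBasisOfDegrees V d P) :
    ∀ l ≤ p, Associated (tailWronskian P l) (pointPolynomial z m k t l) := by
  obtain ⟨Q, hQ, h1⟩ := h
  exact fun l hl => (hP.associated_tailWronskian hd hQ l).trans (h1 l hl)

/-- Left to right only membership in the domain matters. Right to left the Bethe equations come for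
free, the polynomials being Wronskians. -/
lemma Corresponds.mem_criticalPoints_iff (hp : 2 ≤ p) (hm : ∀ j, 0 < m j) (hd : StrictAnti d)
    {t : VarIndex k → ℂ} {V : Submodule ℂ ℂ[X]} (h : Corresponds z m k d t V) :
    t ∈ criticalPoints z m k (masterDomain z k) ↔ IsNondegenerate V d := by
  constructor
  · intro ht
    obtain ⟨P, hP, h1⟩ := h
    refine ⟨P, hP, fun l hl => ?_⟩
    rw [noCommonRoots_tailWronskian_iff h1 (by omega) (by omega)]
    exact ((mem_masterDomain_iff z m k hp hm).mp ht.1).2 l hl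
  · rintro ⟨P, hP, h1⟩
    have h2 := h.associated hd hP
    have h3 : ∀ j ≤ p, Associated (wr (reversedSequence P) j) (tailWronskian P (p - j)) := by
      intro j hj
      have := _root_.associated_tailWronskian P (p - j)
      rw [Nat.sub_sub_self hj] at this
      exact this.symm
    refine (_root_.mem_criticalPoints_iff z m k hp hm).mpr
      ((isBetheTuple_wr (hP.distinctDegrees hd) fun j hj => ?_).of_associated
        fun j hj => (h3 j hj).trans (h2 (p - j) (Nat.sub_le _ _)))
    rcases Nat.eq_zero_or_pos j with rfl | h0
    · rw [wr_zero]
      exact (noCommonRoots_one_right _).symm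
    · have h4 := h1 (p - (j + 1)) (by omega)
      rw [show p - (j + 1) + 1 = p - j by omega] at h4
      exact ((h3 (j + 1) hj).symm.noCommonRoots (h3 j hj.le).symm h4).symm

lemma Corresponds.mem_configurationSpace_iff (hp : 2 ≤ p) (hm : ∀ j, 0 < m j) (hd : StrictAnti d)
    {t : VarIndex k → ℂ} {V : Submodule ℂ ℂ[X]} (h : Corresponds z m k d t V) :
    t ∈ criticalPoints z m k (configurationSpace z k) ↔ IsStronglyNondegenerate V d := by
  constructor
  · intro ht
    obtain ⟨P, hP, h1⟩ := h
    refine ⟨P, hP, fun l l' hl hl' => ?_⟩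
    rw [noCommonRoots_tailWronskian_iff h1 (by omega) (by omega)]
    exact ((_root_.mem_configurationSpace_iff z m k hp hm).mp ht.1).2 l l' hl hl'
  · rintro ⟨P, hP, h1⟩
    have ht := (h.mem_criticalPoints_iff hp hm hd).mpr
      ⟨P, hP, fun l hl => h1 l (l + 1) l.lt_succ_self hl⟩
    refine ⟨(_root_.mem_configurationSpace_iff z m k hp hm).mpr ⟨ht.1, fun l l' hl hl' => ?_⟩, ht.2⟩
    rw [← noCommonRoots_tailWronskian_iff (h.associated hd hP) (by omega) (by omega)]
    exact h1 l l' hl hl'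

lemma exists_corresponds_of_mem_criticalPoints (hp : 2 ≤ p) (hm : ∀ j, 0 < m j) (hd : StrictAnti d)
    (hdk : DegreeCondition m k d) {t : VarIndex k → ℂ}
    (ht : t ∈ criticalPoints z m k (masterDomain z k)) : ∃ V, Corresponds z m k d t V := by
  have hY := (mem_criticalPoints_iff z m k hp hm).mp ht
  obtain ⟨f, hf, hfY⟩ := hY.exists_sequence (e := reversedDegrees d) (fun j hj => by
    rw [pointPolynomial_natDegree, pointPolynomial_natDegree]
    exact hdk.reversedDegrees_add j hj) (reversedDegrees_lt hd)
  let P : Fin p → ℂ[X] := fun l => f (p - 1 - l)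
  have hPf : ∀ j < p, reversedSequence P j = f j := by
    intro j hj
    rw [reversedSequence, dif_pos hj]
    simp only [P]
    congr 1
    omega
  have h1 : ∀ l ≤ p, Associated (tailWronskian P l) (pointPolynomial z m k t l) := by
    intro l hl
    refine (associated_tailWronskian P l).trans ?_
    rw [wr_congr (g := f) fun j hj => hPf j (by omega)]
    have := hfY (p - l) (Nat.sub_le _ _)
    rwa [Nat.sub_sub_self hl] at this
  refine ⟨Submodule.span ℂ (Set.range P), P, ⟨?_, rfl, fun l => ?_⟩, h1⟩
  · refine linearIndependent_of_wronskianDet_ne_zero ?_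
    rw [← tailWronskian_zero]
    exact (h1 0 p.zero_le).ne_zero_iff.mpr (pointPolynomial_monic z m k t 0).ne_zero
  · have hl := l.isLt
    change (f (p - 1 - l)).degree = _
    rw [hf _ (by omega), reversedDegrees, dif_pos (by omega)]
    congr 2
    exact Fin.ext (by simp only; omega)

/-- The point lists the roots of the tail Wronskians. Without nondegeneracy roots may coincide, so
`t` need not lie in the domain. -/
lemma exists_corresponds_of_isPlaneWithWronskian (hp : 2 ≤ p) (hd : StrictAnti d)
    (hdk : DegreeCondition m k d) {V : Submodule ℂ ℂ[X]} {P : Fin p → ℂ[X]}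
    (hP : IsBasisOfDegrees V d P) (hV : IsPlaneWithWronskian p V (targetPolynomial z m)) :
    ∃ t, Corresponds z m k d t V := by
  have h1 : ∀ l : Fin (p - 1), ∃ c : Fin (k l) → ℂ,
      Associated (tailWronskian P (l + 1)) (∏ i, (X - C (c i))) := by
    intro l
    have hl := l.isLt
    obtain ⟨h2, h3⟩ := hP.natDegree_tailWronskian (by omega) hd hdk (l := l + 1) (by omega)
    refine exists_associated_prod_X_sub_C h2 ?_
    simpa [extendedK] using h3
  choose c hc using h1
  refine ⟨fun b => c b.1 b.2, P, hP, fun l hl => ?_⟩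
  rcases l with _ | l
  -- The polynomial of index `0` is `W` for every point, so the zero point serves here.
  · exact (hP.isPlaneWithWronskian_iff (pointPolynomial_monic z m k (fun _ => 0) 0)).mp hV
  · rcases hl.lt_or_eq with hl | rfl
    · have := pointPolynomial_succ z m k (fun b => c b.1 b.2) ⟨l, by omega⟩
      simp only at this
      rw [this]
      exact hc ⟨l, by omega⟩
    · rw [pointPolynomial_of_le z m k _ (by omega) le_rfl]
      exact tailWronskian_self P

/-- Both flags have the same Wronskians up to scalars, hence the same span. -/
lemma Corresponds.eq_plane (hd : StrictAnti d) {t : VarIndex k → ℂ} {V V' : Submodule ℂ ℂ[X]}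
    (h : Corresponds z m k d t V) (h' : Corresponds z m k d t V') : V = V' := by
  obtain ⟨P, hP, h1⟩ := h
  obtain ⟨P', hP', h1'⟩ := h'
  have h2 : ∀ r ≤ p, Associated (wr (reversedSequence P) r) (wr (reversedSequence P') r) := by
    intro r hr
    have e1 := associated_tailWronskian P (p - r)
    have e2 := associated_tailWronskian P' (p - r)
    rw [Nat.sub_sub_self hr] at e1 e2
    exact e1.symm.trans ((h1 _ (Nat.sub_le _ _)).trans ((h1' _ (Nat.sub_le _ _)).symm.trans e2))
  have hdd := hP.distinctDegrees hd
  have hdd' := hP'.distinctDegrees hd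
  rw [← hP.spanLT_eq, ← hP'.spanLT_eq]
  exact le_antisymm (spanLT_le_of_associated_wr hdd' hdd fun r hr => (h2 r hr).symm)
    (spanLT_le_of_associated_wr hdd hdd' h2)

lemma permSetoid_of_groupPolynomial_eq {t t' : VarIndex k → ℂ}
    (h : ∀ l, groupPolynomial k t l = groupPolynomial k t' l) : permSetoid k t t' := by
  have h1 : ∀ l : Fin (p - 1), ∃ σ : Equiv.Perm (Fin (k l)), ∀ i, t' ⟨l, i⟩ = t ⟨l, σ i⟩ := by
    intro l
    refine exists_perm_of_map_univ_eq (f := fun i => t ⟨l, i⟩) (g := fun i => t' ⟨l, i⟩) ?_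
    have h2 : ∀ s : VarIndex k → ℂ, (groupPolynomial k s l).roots =
        Finset.univ.val.map fun i => s ⟨l, i⟩ := by
      intro s
      rw [← roots_multiset_prod_X_sub_C (Finset.univ.val.map fun i => s ⟨l, i⟩), Multiset.map_map]
      rfl
    rw [← h2, ← h2, h]
  choose σ hσ using h1
  exact ⟨σ, hσ⟩

lemma pointPolynomial_eq_of_permSetoid {t t' : VarIndex k → ℂ} (h : permSetoid k t t') (l : ℕ) :
    pointPolynomial z m k t l = pointPolynomial z m k t' l := by
  obtain ⟨σ, hσ⟩ := h
  rcases l with _ | l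
  · rfl
  · simp only [pointPolynomial]
    split_ifs with hl
    · unfold groupPolynomial
      simp only [hσ]
      exact (Equiv.prod_comp (σ ⟨l, hl⟩) fun i => X - C (t ⟨⟨l, hl⟩, i⟩)).symm
    · rfl

lemma Corresponds.permSetoid (hd : StrictAnti d) {t t' : VarIndex k → ℂ} {V : Submodule ℂ ℂ[X]}
    (h : Corresponds z m k d t V) (h' : Corresponds z m k d t' V) : permSetoid k t t' := by
  obtain ⟨P, hP, h1⟩ := h
  have h1' := h'.associated hd hP
  refine permSetoid_of_groupPolynomial_eq fun l => ?_
  have hl : (l : ℕ) + 1 ≤ p := by have := l.isLt; omega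
  rw [← pointPolynomial_succ z m k, ← pointPolynomial_succ z m k]
  exact eq_of_monic_of_associated (pointPolynomial_monic z m k t _)
    (pointPolynomial_monic z m k t' _) ((h1 _ hl).symm.trans (h1' _ hl))

lemma Corresponds.of_permSetoid {t t' : VarIndex k → ℂ} {V : Submodule ℂ ℂ[X]}
    (h : Corresponds z m k d t V) (ht : _root_.permSetoid k t t') : Corresponds z m k d t' V := by
  obtain ⟨P, hP, h1⟩ := h
  refine ⟨P, hP, fun l hl => ?_⟩
  rw [← pointPolynomial_eq_of_permSetoid ht]
  exact h1 l hl

/-- The correspondence between orbits of points and planes is bijective between a set of critical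
points and a set of planes that match under it. -/
lemma mk_orbitsOf_eq (hp : 2 ≤ p) (hm : ∀ j, 0 < m j) (hd : StrictAnti d)
    (hdk : DegreeCondition m k d) {A : Set (VarIndex k → ℂ)} {N : Submodule ℂ ℂ[X] → Prop}
    (hA : A ⊆ criticalPoints z m k (masterDomain z k))
    (hN : ∀ V, N V → ∃ P, IsBasisOfDegrees V d P)
    (hAN : ∀ t V, Corresponds z m k d t V → (t ∈ A ↔ N V)) :
    Cardinal.mk (OrbitsOf k A) = Cardinal.mk {V : Submodule ℂ ℂ[X] //
      N V ∧ IsPlaneWithWronskian p V (targetPolynomial z m)} := by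
  choose F hF using fun t : A =>
    exists_corresponds_of_mem_criticalPoints hp hm hd hdk (hA t.2)
  let G : A → {V : Submodule ℂ ℂ[X] // N V ∧ IsPlaneWithWronskian p V (targetPolynomial z m)} :=
    fun t => ⟨F t, (hAN t (F t) (hF t)).mp t.2, (hF t).isPlaneWithWronskian⟩
  have hG : Function.Surjective G := by
    rintro ⟨V, hV, hW⟩
    obtain ⟨P, hP⟩ := hN V hV
    obtain ⟨t, ht⟩ := exists_corresponds_of_isPlaneWithWronskian hp hd hdk hP hW
    refine ⟨⟨t, (hAN t V ht).mpr hV⟩, Subtype.ext ?_⟩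
    exact (hF _).eq_plane hd ht
  -- The fibres of `G` are exactly the orbits: the plane depends only on the polynomials `y_l`, and
  -- it determines them because they are monic.
  have hker : (permSetoid k).comap (Subtype.val : A → VarIndex k → ℂ) = Setoid.ker G := by
    ext t t'
    rw [Setoid.comap_rel, Setoid.ker_def]
    constructor
    · intro h
      exact Subtype.ext (((hF t).of_permSetoid h).eq_plane hd (hF t'))
    · intro h
      have h1 : F t = F t' := congrArg Subtype.val h
      have h2 := hF t'
      rw [← h1] at h2
      exact (hF t).permSetoid hd h2
  unfold OrbitsOf
  rw [hker]
  exact Cardinal.mk_congr (Setoid.quotientKerEquivOfSurjective G hG)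

end Main

theorem corollary4 (p n : ℕ) (hp : 2 ≤ p)
    (z : Fin n → ℂ) (hz : Function.Injective z)
    (m : Fin n → ℕ) (hm : ∀ j, 0 < m j)
    (k : Fin (p - 1) → ℕ)
    (d : Fin p → ℕ) (hd : StrictAnti d)
    (hdk : ∀ l : Fin p, (d l : ℤ) =
      (extendedK m k l : ℤ) - (extendedK m k (l + 1) : ℤ) + ((p : ℤ) - ((l : ℤ) + 1))) :
    Cardinal.mk (OrbitsOf k (criticalPoints z m k (masterDomain z k))) =
        Cardinal.mk {V : Submodule ℂ ℂ[X] //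
          IsNondegenerate V d ∧ IsPlaneWithWronskian p V (targetPolynomial z m)} ∧
      Cardinal.mk (OrbitsOf k (criticalPoints z m k (configurationSpace z k))) =
        Cardinal.mk {V : Submodule ℂ ℂ[X] //
          IsStronglyNondegenerate V d ∧
            IsPlaneWithWronskian p V (targetPolynomial z m)} := by
  constructor
  · exact mk_orbitsOf_eq hp hm hd hdk subset_rfl (fun V ⟨P, hP, _⟩ => ⟨P, hP⟩)
      fun t V h => h.mem_criticalPoints_iff hp hm hd
  · exact mk_orbitsOf_eq hp hm hd hdk
      (fun t ht => ⟨((mem_configurationSpace_iff z m k hp hm).mp ht.1).1, ht.2⟩)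
      (fun V ⟨P, hP, _⟩ => ⟨P, hP⟩) fun t V h => h.mem_configurationSpace_iff hp hm hd
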